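/- Let $s=(s_n)_{n\ge0}$ be a normalized Stieltjes moment sequence ($s_0=1$) which is indeterminate in the sense of Stieltjes, i.e. there is more than one probability measure supported by $[0,\infty)$ with moment sequence $s$. Let $V$ be the set of all probability measures $\mu$ on $\mathbb R$ having moments of every order with $\int x^n\,d\mu(x)=s_n$ for all $n\ge 0$ (the solutions of the Hamburger problem), and put $\xi(\mu)=\inf\operatorname{supp}(\mu)\in[-\infty,\infty)$ for $\mu\in V$. Let $P_n$ ($\deg P_n=n$, positive leading coefficient) be the orthonormal polynomials of $s$, let $a_n=\int xP_n^2\,d\mu$ and $b_n=\int xP_nP_{n+1}\,d\mu$ ($\mu\in V$), and let $Q_n$ be the polynomials of the second kind, given by $Q_0=0$, $Q_1=1/b_0$ and $xQ_n=b_nQ_{n+1}+a_nQ_n+b_{n-1}Q_{n-1}$ for $n\ge1$. Let $$A(z)=z\sum_{k\ge0}Q_k(z)Q_k(0),\quad B(z)=-1+z\sum_{k\ge0}P_k(z)Q_k(0),$$ $$C(z)=1+z\sum_{k\ge0}Q_k(z)P_k(0),\quad D(z)=z\sum_{k\ge0}P_k(z)P_k(0)$$ be the Nevanlinna functions of $s$.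 Then the limit $\alpha(s)=\lim_{n\to\infty}P_n(0)/Q_n(0)$ exists and is negative; the limit $\xi_1=\lim_{n\to\infty}x_{n,1}$ exists in $\mathbb R$, where $x_{n,1}$ is the smallest zero of $P_n$, $n\ge 1$; and there is exactly one $\nu_{\alpha(s)}\in V$ (the Friedrichs solution) such that $$\int\frac{d\nu_{\alpha(s)}(x)}{x-z}=-\frac{A(z)\alpha(s)-C(z)}{B(z)\alpha(s)-D(z)},\qquad z\in\mathbb C\setminus\mathbb R.$$ Moreover $\xi(\nu_{\alpha(s)})=\xi_1$, and every $\nu\in V$ with $\nu\neq\nu_{\alpha(s)}$ satisfies $$\xi(\nu)<\xi(\nu_{\alpha(s)})=\xi_1 .$$ -/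

import Mathlib

open MeasureTheory Filter Topology Polynomial

noncomputable section

namespace MomentProblem

/-- `μ` is a solution of the (normalized) Hamburger moment problem for `s`: a probability measure
on `ℝ` with moments of every order, equal to those prescribed by `s`. -/
structure IsHamburgerSolution (s : ℕ → ℝ) (μ : Measure ℝ) : Prop where
  isProbabilityMeasure : IsProbabilityMeasure μ
  integrable_pow : ∀ n : ℕ, Integrable (fun x : ℝ => x ^ n) μ
  integral_pow : ∀ n : ℕ, ∫ x, x ^ n ∂μ = s n

/-- A solution of the Stieltjes problem: a Hamburger solution supported by `[0, ∞)`. -/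
def IsStieltjesSolution (s : ℕ → ℝ) (μ : Measure ℝ) : Prop :=
  IsHamburgerSolution s μ ∧ μ.support ⊆ Set.Ici 0

/-- `s` is a normalized Stieltjes moment sequence that is indeterminate in the sense of Stieltjes:
more than one solution is supported by `[0, ∞)`. -/
def IsIndetStieltjes (s : ℕ → ℝ) : Prop :=
  ∃ μ₁ μ₂ : Measure ℝ, IsStieltjesSolution s μ₁ ∧ IsStieltjesSolution s μ₂ ∧ μ₁ ≠ μ₂

/-- The infimum of the support, as an extended real (it may be `-∞`). -/
def infSupport (μ : Measure ℝ) : EReal :=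
  sInf ((fun x : ℝ => (x : EReal)) '' μ.support)

/-- The linear functional on real polynomials with `X ^ n ↦ s n`; it is integration against any
solution of the moment problem. -/
def momentFunctional (s : ℕ → ℝ) : ℝ[X] →ₗ[ℝ] ℝ :=
  Polynomial.lsum fun n => s n • LinearMap.id

/-- The monic orthogonal polynomials of `s` (Gram-Schmidt applied to `1, X, X ^ 2, …`). -/
def monicOrthogonal (s : ℕ → ℝ) (n : ℕ) : ℝ[X] :=
  X ^ n - ∑ k : Fin n,
    C (momentFunctional s (X ^ n * monicOrthogonal s k) /
        momentFunctional s (monicOrthogonal s k * monicOrthogonal s k)) * monicOrthogonal s k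
termination_by n
decreasing_by all_goals exact k.isLt

/-- The orthonormal polynomials `P_n` (degree `n`, positive leading coefficient). -/
def orthP (s : ℕ → ℝ) (n : ℕ) : ℝ[X] :=
  C (1 / √(momentFunctional s (monicOrthogonal s n * monicOrthogonal s n))) * monicOrthogonal s n

/-- The Jacobi parameters `a_n = ∫ x P_n(x)² dμ(x)`. -/
def jacobiA (s : ℕ → ℝ) (n : ℕ) : ℝ := momentFunctional s (X * orthP s n ^ 2)

/-- The Jacobi parameters `b_n = ∫ x P_n(x) P_{n+1}(x) dμ(x)`. -/
def jacobiB (s : ℕ → ℝ) (n : ℕ) : ℝ := momentFunctional s (X * orthP s n * orthP s (n + 1))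

/-- The polynomials of the second kind `Q_n`: `Q_0 = 0`, `Q_1 = 1 / b_0` and
`x Q_n = b_n Q_{n+1} + a_n Q_n + b_{n-1} Q_{n-1}` for `n ≥ 1`. -/
def orthQ (s : ℕ → ℝ) : ℕ → ℝ[X]
  | 0 => 0
  | 1 => C (1 / jacobiB s 0)
  | n + 2 => C (1 / jacobiB s (n + 1)) *
      ((X - C (jacobiA s (n + 1))) * orthQ s (n + 1) - C (jacobiB s n) * orthQ s n)

/-- The two-variable Nevanlinna function `A(u, v)`. -/
def nevA₂ (s : ℕ → ℝ) (u v : ℂ) : ℂ :=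
  (u - v) * ∑' k : ℕ, aeval u (orthQ s k) * aeval v (orthQ s k)

/-- The two-variable Nevanlinna function `B(u, v)`. -/
def nevB₂ (s : ℕ → ℝ) (u v : ℂ) : ℂ :=
  -1 + (u - v) * ∑' k : ℕ, aeval u (orthP s k) * aeval v (orthQ s k)

/-- The two-variable Nevanlinna function `C(u, v)`. -/
def nevC₂ (s : ℕ → ℝ) (u v : ℂ) : ℂ :=
  1 + (u - v) * ∑' k : ℕ, aeval u (orthQ s k) * aeval v (orthP s k)

/-- The two-variable Nevanlinna function `D(u, v)`. -/
def nevD₂ (s : ℕ → ℝ) (u v : ℂ) : ℂ :=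
  (u - v) * ∑' k : ℕ, aeval u (orthP s k) * aeval v (orthP s k)

/-- The Nevanlinna function `A(z) = A(z, 0)`. -/
def nevA (s : ℕ → ℝ) (z : ℂ) : ℂ := nevA₂ s z 0

/-- The Nevanlinna function `B(z) = B(z, 0)`. -/
def nevB (s : ℕ → ℝ) (z : ℂ) : ℂ := nevB₂ s z 0

/-- The Nevanlinna function `C(z) = C(z, 0)`. -/
def nevC (s : ℕ → ℝ) (z : ℂ) : ℂ := nevC₂ s z 0

/-- The Nevanlinna function `D(z) = D(z, 0)`. -/
def nevD (s : ℕ → ℝ) (z : ℂ) : ℂ := nevD₂ s z 0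

/-- `μ` is the N-extremal solution `ν_t`, `t ∈ ℝ`: the Hamburger solution that corresponds to the
constant Pick function `t` in the Nevanlinna parametrization. -/
def IsNExtremal (s : ℕ → ℝ) (t : ℝ) (μ : Measure ℝ) : Prop :=
  IsHamburgerSolution s μ ∧
    ∀ z : ℂ, z.im ≠ 0 →
      ∫ x : ℝ, 1 / ((x : ℂ) - z) ∂μ =
        -((nevA s z * (t : ℂ) - nevC s z) / (nevB s z * (t : ℂ) - nevD s z))

/-- `α = α(s)`, that is, `α = lim P_n(0) / Q_n(0)`. -/
def IsAlpha (s : ℕ → ℝ) (α : ℝ) : Prop :=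
  Tendsto (fun n : ℕ => (orthP s n).eval 0 / (orthQ s n).eval 0) atTop (𝓝 α)

/-- The smallest zero `x_{n,1}` of `P_n`, for `n ≥ 1`. -/
def smallestZero (s : ℕ → ℝ) (n : ℕ) : ℝ := sInf {x : ℝ | (orthP s n).eval x = 0}

/-- `ξ₁ = lim x_{n,1}`, the limit of the smallest zeros of the orthonormal polynomials. -/
def IsXiOne (s : ℕ → ℝ) (ξ₁ : ℝ) : Prop :=
  Tendsto (fun n : ℕ => smallestZero s n) atTop (𝓝 ξ₁)

end MomentProblem

end

open MomentProblem

/-!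
Two different solutions make the moment functional strictly positive and force Weyl's limit circle
case: comparing the orthogonal expansions of the resolvent `1 / (x - z)` in the two solutions, at a
point where their Stieltjes transforms differ, shows that `(P_n(z))` and `(Q_n(z))` are square
summable. This propagates locally uniformly to all `z`, so the Nevanlinna functions converge.

If some solution is supported by `[p, ∞)`, then `-Q_n(p) / P_n(p)` is positive and increasing, and
Gauss-type quadratures bound the Stieltjes transform of every such solution at `y < p` from both
sides. When `-Q_n(p) / P_n(p) → ∞` the bounds coincide in the limit, so the solution on `[p, ∞)` is
unique. At `p = 0` there are two solutions by assumption, hence the limit is finite and `α < 0`. At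
`p = ξ₁` the ratio does diverge, because zeros of `P_n` converge to `ξ₁`. A weak limit of the Gauss
quadratures, whose nodes lie in `(ξ₁, ∞)` and whose Stieltjes transforms are `-Q_n / P_n`, is a
solution with parameter `α`, supported by `[ξ₁, ∞)`; every other solution therefore has mass to the
left of `ξ₁`.
-/

noncomputable section

namespace MomentProblem

variable {s : ℕ → ℝ}

/-- The moment functional of `s` is normalized and strictly positive on squares, which is what makes
the orthonormal polynomials well defined. -/
structure IsPosDef (s : ℕ → ℝ) : Prop where
  map_one : momentFunctional s 1 = 1
  pos : ∀ p : ℝ[X], p ≠ 0 → 0 < momentFunctional s (p * p)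

/-! ### Orthonormal polynomials -/

lemma momentFunctional_C_mul (a : ℝ) (p : ℝ[X]) :
    momentFunctional s (C a * p) = a * momentFunctional s p := by
  rw [← smul_eq_C_mul, map_smul, smul_eq_mul]

lemma momentFunctional_X_pow (k : ℕ) : momentFunctional s (X ^ k) = s k := by
  rw [momentFunctional, lsum_apply, X_pow_eq_monomial, sum_monomial_index] <;> simp

lemma monicOrthogonal_eq_X_pow_sub (s : ℕ → ℝ) (n : ℕ) :
    monicOrthogonal s n = X ^ n - ∑ k ∈ Finset.range n,
      C (momentFunctional s (X ^ n * monicOrthogonal s k) /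
        momentFunctional s (monicOrthogonal s k * monicOrthogonal s k)) * monicOrthogonal s k := by
  rw [monicOrthogonal, Finset.sum_range]

lemma monicOrthogonal_zero : monicOrthogonal s 0 = 1 := by
  rw [monicOrthogonal_eq_X_pow_sub, Finset.sum_range_zero, sub_zero, pow_zero]

lemma degree_monicOrthogonal_sub_X_pow_lt (s : ℕ → ℝ) (n : ℕ) :
    (monicOrthogonal s n - X ^ n).degree < (n : WithBot ℕ) := by
  induction n using Nat.strong_induction_on with
  | _ n ih =>
    rw [monicOrthogonal_eq_X_pow_sub, sub_sub_cancel_left, degree_neg, ← mem_degreeLT]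
    refine Submodule.sum_mem _ fun k hk => ?_
    rw [← smul_eq_C_mul]
    refine Submodule.smul_mem _ _ (mem_degreeLT.2 ?_)
    have hkn : (k : WithBot ℕ) < n := by exact_mod_cast Finset.mem_range.1 hk
    rw [← sub_add_cancel (monicOrthogonal s k) (X ^ k)]
    refine (degree_add_le _ _).trans_lt (max_lt ?_ ?_)
    · exact (ih k (Finset.mem_range.1 hk)).trans hkn
    · rwa [degree_X_pow]

lemma monic_monicOrthogonal (s : ℕ → ℝ) (n : ℕ) : (monicOrthogonal s n).Monic := by
  simpa using monic_X_pow_add (degree_monicOrthogonal_sub_X_pow_lt s n)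

lemma natDegree_monicOrthogonal (s : ℕ → ℝ) (n : ℕ) : (monicOrthogonal s n).natDegree = n := by
  have hdeg : (monicOrthogonal s n - X ^ n).degree < (X ^ n : ℝ[X]).degree := by
    simpa only [degree_X_pow] using degree_monicOrthogonal_sub_X_pow_lt s n
  refine natDegree_eq_of_degree_eq_some ?_
  rw [← sub_add_cancel (monicOrthogonal s n) (X ^ n), degree_add_eq_right_of_degree_lt hdeg,
    degree_X_pow]

namespace IsPosDef

lemma monicOrthogonal_sq_pos (h : IsPosDef s) (n : ℕ) :
    0 < momentFunctional s (monicOrthogonal s n * monicOrthogonal s n) :=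
  h.pos _ (monic_monicOrthogonal s n).ne_zero

lemma monicOrthogonal_mul_of_lt (h : IsPosDef s) {n k : ℕ} (hk : k < n) :
    momentFunctional s (monicOrthogonal s n * monicOrthogonal s k) = 0 := by
  induction n using Nat.strong_induction_on generalizing k with
  | _ n ih =>
    have orthogonal : ∀ j < n, j ≠ k →
        momentFunctional s (monicOrthogonal s j * monicOrthogonal s k) = 0 := by
      intro j hj hjk
      rcases lt_or_gt_of_ne hjk with hlt | hgt
      · rw [mul_comm]; exact ih k hk hlt
      · exact ih j hj hgt
    rw [monicOrthogonal_eq_X_pow_sub s n, sub_mul, map_sub, Finset.sum_mul, map_sum,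
      Finset.sum_eq_single_of_mem k (Finset.mem_range.2 hk)]
    · rw [mul_assoc, momentFunctional_C_mul, div_mul_cancel₀ _ (h.monicOrthogonal_sq_pos k).ne',
        sub_self]
    · intro j hj hjk
      rw [mul_assoc, momentFunctional_C_mul, orthogonal j (Finset.mem_range.1 hj) hjk, mul_zero]

lemma normalizer_pos (h : IsPosDef s) (n : ℕ) :
    0 < 1 / √(momentFunctional s (monicOrthogonal s n * monicOrthogonal s n)) :=
  one_div_pos.2 (Real.sqrt_pos.2 (h.monicOrthogonal_sq_pos n))

lemma natDegree_orthP (h : IsPosDef s) (n : ℕ) : (orthP s n).natDegree = n := by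
  rw [orthP, natDegree_C_mul (h.normalizer_pos n).ne', natDegree_monicOrthogonal]

lemma leadingCoeff_orthP_pos (h : IsPosDef s) (n : ℕ) : 0 < (orthP s n).leadingCoeff := by
  rw [orthP, leadingCoeff_mul, leadingCoeff_C, (monic_monicOrthogonal s n).leadingCoeff, mul_one]
  exact h.normalizer_pos n

lemma orthP_ne_zero (h : IsPosDef s) (n : ℕ) : orthP s n ≠ 0 :=
  leadingCoeff_ne_zero.1 (h.leadingCoeff_orthP_pos n).ne'

lemma degree_orthP (h : IsPosDef s) (n : ℕ) : (orthP s n).degree = n := by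
  rw [degree_eq_natDegree (h.orthP_ne_zero n), h.natDegree_orthP]

lemma orthP_zero (h : IsPosDef s) : orthP s 0 = 1 := by
  simp [orthP, monicOrthogonal_zero, h.map_one]

lemma momentFunctional_orthP_mul_orthP (h : IsPosDef s) (n k : ℕ) :
    momentFunctional s (orthP s n * orthP s k) = if n = k then 1 else 0 := by
  rw [orthP, orthP, mul_mul_mul_comm, ← C_mul, momentFunctional_C_mul]
  split_ifs with hnk
  · subst hnk
    rw [div_mul_div_comm, Real.mul_self_sqrt (h.monicOrthogonal_sq_pos n).le, one_mul,
      one_div_mul_cancel (h.monicOrthogonal_sq_pos n).ne']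
  · rcases lt_or_gt_of_ne hnk with hlt | hgt
    · rw [mul_comm (monicOrthogonal s n) (monicOrthogonal s k),
        h.monicOrthogonal_mul_of_lt hlt, mul_zero]
    · rw [h.monicOrthogonal_mul_of_lt hgt, mul_zero]

lemma span_orthP (h : IsPosDef s) (n : ℕ) :
    Submodule.span ℝ (orthP s '' Set.Iio n) = degreeLT ℝ n :=
  Sequence.span_degreeLT ⟨orthP s, h.degree_orthP⟩
    fun k _ => (h.leadingCoeff_orthP_pos k).ne'.isUnit

lemma momentFunctional_orthP_mul_of_degree_lt (h : IsPosDef s) {n : ℕ} {q : ℝ[X]}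
    (hq : q.degree < n) : momentFunctional s (orthP s n * q) = 0 := by
  rw [← mem_degreeLT, ← h.span_orthP] at hq
  induction hq using Submodule.span_induction with
  | mem _ hp =>
    obtain ⟨k, hk, rfl⟩ := hp
    rw [h.momentFunctional_orthP_mul_orthP, if_neg (ne_of_gt hk)]
  | zero => rw [mul_zero, map_zero]
  | add p q _ _ ihp ihq => rw [mul_add, map_add, ihp, ihq, add_zero]
  | smul c p _ ih => rw [mul_smul_comm, map_smul, ih, smul_zero]

lemma sum_momentFunctional_mul_orthP (h : IsPosDef s) {n : ℕ} {q : ℝ[X]} (hq : q.degree < n) :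
    ∑ k ∈ Finset.range n, C (momentFunctional s (q * orthP s k)) * orthP s k = q := by
  rw [← mem_degreeLT, ← h.span_orthP] at hq
  induction hq using Submodule.span_induction with
  | mem _ hp =>
    obtain ⟨k, hk, rfl⟩ := hp
    rw [Finset.sum_eq_single_of_mem k (Finset.mem_range.2 hk)]
    · rw [h.momentFunctional_orthP_mul_orthP, if_pos rfl, C_1, one_mul]
    · intro j _ hjk
      rw [h.momentFunctional_orthP_mul_orthP, if_neg hjk.symm, C_0, zero_mul]
  | zero => simp
  | add p q _ _ ihp ihq =>
    simp only [add_mul, map_add, Finset.sum_add_distrib, ihp, ihq]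
  | smul c p _ ih =>
    simp only [smul_eq_C_mul, mul_assoc, momentFunctional_C_mul, C_mul, ← Finset.mul_sum, ih]

/-! ### The three-term recurrence -/

lemma degree_X_mul_orthP_lt (h : IsPosDef s) (n : ℕ) :
    (X * orthP s n).degree < ((n + 2 : ℕ) : WithBot ℕ) := by
  rw [degree_mul, degree_X, h.degree_orthP]
  norm_cast; omega

lemma X_mul_orthP_zero (h : IsPosDef s) :
    X * orthP s 0 = C (jacobiB s 0) * orthP s 1 + C (jacobiA s 0) * orthP s 0 := by
  conv_lhs => rw [← h.sum_momentFunctional_mul_orthP (h.degree_X_mul_orthP_lt 0)]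
  rw [Finset.sum_range_succ, Finset.sum_range_one, add_comm, jacobiA, jacobiB, sq, mul_assoc,
    mul_assoc]

lemma X_mul_orthP_succ (h : IsPosDef s) (n : ℕ) :
    X * orthP s (n + 1) = C (jacobiB s (n + 1)) * orthP s (n + 2) +
      C (jacobiA s (n + 1)) * orthP s (n + 1) + C (jacobiB s n) * orthP s n := by
  have vanish : ∀ k ∈ Finset.range n,
      C (momentFunctional s (X * orthP s (n + 1) * orthP s k)) * orthP s k = 0 := by
    intro k hk
    have hdeg : (X * orthP s k).degree < ((n + 1 : ℕ) : WithBot ℕ) :=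
      (h.degree_X_mul_orthP_lt k).trans_le
        (by exact_mod_cast Nat.succ_le_succ (Finset.mem_range.1 hk))
    rw [mul_right_comm, mul_comm, mul_comm (X * _),
      h.momentFunctional_orthP_mul_of_degree_lt hdeg, C_0, mul_zero]
  conv_lhs => rw [← h.sum_momentFunctional_mul_orthP (h.degree_X_mul_orthP_lt (n + 1))]
  rw [Finset.sum_range_succ, Finset.sum_range_succ, Finset.sum_range_succ,
    Finset.sum_eq_zero vanish, mul_right_comm X, mul_assoc X (orthP s (n + 1)) (orthP s (n + 1)),
    ← sq, ← jacobiA, ← jacobiB, ← jacobiB]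
  ring

lemma jacobiB_pos (h : IsPosDef s) (n : ℕ) : 0 < jacobiB s n := by
  have coeff_succ : ∀ k < n + 1, (orthP s k).coeff (n + 1) = 0 := fun k hk =>
    coeff_eq_zero_of_natDegree_lt (by rwa [h.natDegree_orthP])
  have leadingCoeff_eq :
      (orthP s n).leadingCoeff = jacobiB s n * (orthP s (n + 1)).leadingCoeff := by
    rw [leadingCoeff, leadingCoeff, h.natDegree_orthP, h.natDegree_orthP, ← coeff_X_mul]
    cases n with
    | zero => rw [h.X_mul_orthP_zero]; simp [coeff_succ]
    | succ n => rw [h.X_mul_orthP_succ]; simp [coeff_succ]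
  exact pos_of_mul_pos_left (leadingCoeff_eq ▸ h.leadingCoeff_orthP_pos n)
    (h.leadingCoeff_orthP_pos (n + 1)).le

end IsPosDef

section JacobiRecurrence

variable {K : Type*} [CommRing K] {a b u v p q : ℕ → K} {y z : K}

/-- `u` solves, from index `1` on, the three-term recurrence with Jacobi parameters `a`, `b` at the
spectral parameter `z`. The values `P_n(z)` and `Q_n(z)` form a basis of the solutions. -/
def IsJacobiSolution (a b : ℕ → K) (z : K) (u : ℕ → K) : Prop :=
  ∀ n, z * u (n + 1) = b (n + 1) * u (n + 2) + a (n + 1) * u (n + 1) + b n * u n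

/-- The discrete Wronskian (Casoratian) of two sequences, weighted by the Jacobi parameters `b` so
that it is constant along two solutions of the same recurrence. -/
def jacobiWronskian (b u v : ℕ → K) (n : ℕ) : K :=
  b n * (u (n + 1) * v n - u n * v (n + 1))

lemma IsJacobiSolution.jacobiWronskian_succ (hu : IsJacobiSolution a b z u)
    (hv : IsJacobiSolution a b y v) (n : ℕ) :
    jacobiWronskian b u v (n + 1) =
      jacobiWronskian b u v n + (z - y) * (u (n + 1) * v (n + 1)) := by
  unfold jacobiWronskian
  linear_combination v (n + 1) * -hu n + u (n + 1) * hv n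

lemma jacobiWronskian_plucker (b p q u v : ℕ → K) (n : ℕ) :
    jacobiWronskian b u p n * jacobiWronskian b v q n -
      jacobiWronskian b u q n * jacobiWronskian b v p n =
      jacobiWronskian b u v n * jacobiWronskian b p q n := by
  unfold jacobiWronskian
  ring

lemma jacobiWronskian_mul_sub (b p q u : ℕ → K) (n : ℕ) :
    jacobiWronskian b u p n * q n - jacobiWronskian b u q n * p n =
      jacobiWronskian b q p n * u n := by
  unfold jacobiWronskian
  ring

end JacobiRecurrence

variable {𝕜 : Type*} [RCLike 𝕜]

/-- The value `P_n(z)` at a real or complex point `z`. -/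
abbrev evalP (s : ℕ → ℝ) (z : 𝕜) (n : ℕ) : 𝕜 := aeval z (orthP s n)

/-- The value `Q_n(z)` at a real or complex point `z`. -/
abbrev evalQ (s : ℕ → ℝ) (z : 𝕜) (n : ℕ) : 𝕜 := aeval z (orthQ s n)

lemma evalQ_zero (s : ℕ → ℝ) (z : 𝕜) : evalQ s z 0 = 0 := by
  rw [evalQ, orthQ, map_zero]

namespace IsPosDef

lemma evalP_zero (h : IsPosDef s) (z : 𝕜) : evalP s z 0 = 1 := by
  rw [evalP, h.orthP_zero, _root_.map_one]

lemma jacobiB_mul_evalP_one (h : IsPosDef s) (z : 𝕜) :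
    (jacobiB s 0 : 𝕜) * evalP s z 1 = z - (jacobiA s 0 : 𝕜) := by
  have recurrence := congrArg (aeval z) h.X_mul_orthP_zero
  simp only [h.orthP_zero, mul_one, map_add, map_mul, aeval_X, aeval_C,
    RCLike.algebraMap_eq_ofReal] at recurrence
  exact eq_sub_of_add_eq recurrence.symm

lemma jacobiB_mul_evalQ_one (h : IsPosDef s) (z : 𝕜) : (jacobiB s 0 : 𝕜) * evalQ s z 1 = 1 := by
  rw [evalQ, orthQ, aeval_C, RCLike.algebraMap_eq_ofReal, ← RCLike.ofReal_mul,
    mul_one_div_cancel (h.jacobiB_pos 0).ne', RCLike.ofReal_one]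

lemma isJacobiSolution_evalP (h : IsPosDef s) (z : 𝕜) :
    IsJacobiSolution (fun n => (jacobiA s n : 𝕜)) (fun n => (jacobiB s n : 𝕜)) z (evalP s z) := by
  intro n
  simpa [RCLike.algebraMap_eq_ofReal] using congrArg (aeval z) (h.X_mul_orthP_succ n)

lemma isJacobiSolution_evalQ (h : IsPosDef s) (z : 𝕜) :
    IsJacobiSolution (fun n => (jacobiA s n : 𝕜)) (fun n => (jacobiB s n : 𝕜)) z (evalQ s z) := by
  intro n
  have b_ne_zero : (jacobiB s (n + 1) : 𝕜) ≠ 0 := RCLike.ofReal_ne_zero.2 (h.jacobiB_pos _).ne'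
  simp only [evalQ, orthQ, map_mul, map_sub, aeval_C, aeval_X, RCLike.algebraMap_eq_ofReal,
    RCLike.ofReal_div, RCLike.ofReal_one]
  field_simp
  ring

end IsPosDef

/-! ### Truncated Nevanlinna functions -/

/-- The partial sum of the first `n` terms of the two-variable Nevanlinna function `A(u, v)`. -/
def truncA (s : ℕ → ℝ) (n : ℕ) (u v : 𝕜) : 𝕜 :=
  (u - v) * ∑ k ∈ Finset.range n, evalQ s u k * evalQ s v k

/-- The partial sum of the first `n` terms of the two-variable Nevanlinna function `B(u, v)`. -/
def truncB (s : ℕ → ℝ) (n : ℕ) (u v : 𝕜) : 𝕜 :=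
  -1 + (u - v) * ∑ k ∈ Finset.range n, evalP s u k * evalQ s v k

/-- The partial sum of the first `n` terms of the two-variable Nevanlinna function `C(u, v)`. -/
def truncC (s : ℕ → ℝ) (n : ℕ) (u v : 𝕜) : 𝕜 :=
  1 + (u - v) * ∑ k ∈ Finset.range n, evalQ s u k * evalP s v k

/-- The partial sum of the first `n` terms of the two-variable Nevanlinna function `D(u, v)`. -/
def truncD (s : ℕ → ℝ) (n : ℕ) (u v : 𝕜) : 𝕜 :=
  (u - v) * ∑ k ∈ Finset.range n, evalP s u k * evalP s v k

lemma truncA_succ (s : ℕ → ℝ) (n : ℕ) (u v : 𝕜) :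
    truncA s (n + 1) u v = truncA s n u v + (u - v) * (evalQ s u n * evalQ s v n) := by
  rw [truncA, truncA, Finset.sum_range_succ, mul_add]

lemma truncB_succ (s : ℕ → ℝ) (n : ℕ) (u v : 𝕜) :
    truncB s (n + 1) u v = truncB s n u v + (u - v) * (evalP s u n * evalQ s v n) := by
  rw [truncB, truncB, Finset.sum_range_succ, mul_add, add_assoc]

lemma truncC_succ (s : ℕ → ℝ) (n : ℕ) (u v : 𝕜) :
    truncC s (n + 1) u v = truncC s n u v + (u - v) * (evalQ s u n * evalP s v n) := by
  rw [truncC, truncC, Finset.sum_range_succ, mul_add, add_assoc]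

lemma truncD_succ (s : ℕ → ℝ) (n : ℕ) (u v : 𝕜) :
    truncD s (n + 1) u v = truncD s n u v + (u - v) * (evalP s u n * evalP s v n) := by
  rw [truncD, truncD, Finset.sum_range_succ, mul_add]

namespace IsPosDef

lemma jacobiWronskian_evalQ_evalQ (h : IsPosDef s) (n : ℕ) (u v : 𝕜) :
    jacobiWronskian (fun n => (jacobiB s n : 𝕜)) (evalQ s u) (evalQ s v) n =
      truncA s (n + 1) u v := by
  induction n with
  | zero => simp [jacobiWronskian, truncA, evalQ_zero]
  | succ n ih =>
    rw [(h.isJacobiSolution_evalQ u).jacobiWronskian_succ (h.isJacobiSolution_evalQ v), ih,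
      truncA_succ s (n + 1)]

lemma jacobiWronskian_evalP_evalQ (h : IsPosDef s) (n : ℕ) (u v : 𝕜) :
    jacobiWronskian (fun n => (jacobiB s n : 𝕜)) (evalP s u) (evalQ s v) n =
      truncB s (n + 1) u v := by
  induction n with
  | zero =>
    rw [jacobiWronskian, truncB, Finset.sum_range_one, evalQ_zero, h.evalP_zero]
    linear_combination -h.jacobiB_mul_evalQ_one v
  | succ n ih =>
    rw [(h.isJacobiSolution_evalP u).jacobiWronskian_succ (h.isJacobiSolution_evalQ v), ih,
      truncB_succ s (n + 1)]

lemma jacobiWronskian_evalQ_evalP (h : IsPosDef s) (n : ℕ) (u v : 𝕜) :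
    jacobiWronskian (fun n => (jacobiB s n : 𝕜)) (evalQ s u) (evalP s v) n =
      truncC s (n + 1) u v := by
  induction n with
  | zero =>
    rw [jacobiWronskian, truncC, Finset.sum_range_one, evalQ_zero, h.evalP_zero]
    linear_combination h.jacobiB_mul_evalQ_one u
  | succ n ih =>
    rw [(h.isJacobiSolution_evalQ u).jacobiWronskian_succ (h.isJacobiSolution_evalP v), ih,
      truncC_succ s (n + 1)]

lemma jacobiWronskian_evalP_evalP (h : IsPosDef s) (n : ℕ) (u v : 𝕜) :
    jacobiWronskian (fun n => (jacobiB s n : 𝕜)) (evalP s u) (evalP s v) n =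
      truncD s (n + 1) u v := by
  induction n with
  | zero =>
    rw [jacobiWronskian, truncD, Finset.sum_range_one, h.evalP_zero, h.evalP_zero]
    linear_combination h.jacobiB_mul_evalP_one u - h.jacobiB_mul_evalP_one v
  | succ n ih =>
    rw [(h.isJacobiSolution_evalP u).jacobiWronskian_succ (h.isJacobiSolution_evalP v), ih,
      truncD_succ s (n + 1)]

lemma jacobiWronskian_evalQ_evalP_self (h : IsPosDef s) (n : ℕ) (z : 𝕜) :
    jacobiWronskian (fun n => (jacobiB s n : 𝕜)) (evalQ s z) (evalP s z) n = 1 := by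
  rw [h.jacobiWronskian_evalQ_evalP, truncC, sub_self, zero_mul, add_zero]

lemma evalP_eq_truncD_mul_sub (h : IsPosDef s) (n : ℕ) (u v : 𝕜) :
    evalP s u n = truncD s n u v * evalQ s v n - truncB s n u v * evalP s v n := by
  have variation := jacobiWronskian_mul_sub (fun n => (jacobiB s n : 𝕜)) (evalP s v) (evalQ s v)
    (evalP s u) n
  rw [h.jacobiWronskian_evalP_evalP, h.jacobiWronskian_evalP_evalQ,
    h.jacobiWronskian_evalQ_evalP_self, truncD_succ, truncB_succ] at variation
  linear_combination -variation

lemma evalQ_eq_truncC_mul_sub (h : IsPosDef s) (n : ℕ) (u v : 𝕜) :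
    evalQ s u n = truncC s n u v * evalQ s v n - truncA s n u v * evalP s v n := by
  have variation := jacobiWronskian_mul_sub (fun n => (jacobiB s n : 𝕜)) (evalP s v) (evalQ s v)
    (evalQ s u) n
  rw [h.jacobiWronskian_evalQ_evalP, h.jacobiWronskian_evalQ_evalQ,
    h.jacobiWronskian_evalQ_evalP_self, truncC_succ, truncA_succ] at variation
  linear_combination -variation

lemma truncA_mul_truncD_sub_truncB_mul_truncC (h : IsPosDef s) (n : ℕ) (u v : 𝕜) :
    truncA s n u v * truncD s n u v - truncB s n u v * truncC s n u v = 1 := by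
  cases n with
  | zero => simp [truncA, truncB, truncC, truncD]
  | succ n =>
    have plucker := jacobiWronskian_plucker (fun n => (jacobiB s n : 𝕜)) (evalP s v) (evalQ s v)
      (evalP s u) (evalQ s u) n
    have swap : ∀ z : 𝕜, jacobiWronskian (fun n => (jacobiB s n : 𝕜)) (evalP s z) (evalQ s z) n =
        -1 := fun z => by
      rw [h.jacobiWronskian_evalP_evalQ, truncB, sub_self, zero_mul, add_zero]
    rw [h.jacobiWronskian_evalP_evalP, h.jacobiWronskian_evalP_evalQ,
      h.jacobiWronskian_evalQ_evalQ, h.jacobiWronskian_evalQ_evalP, swap, swap] at plucker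
    linear_combination plucker

end IsPosDef

/-! ### The limit circle case -/

lemma le_mul_exp_of_le_mul_one_add_sum {e v : ℕ → ℝ} {R : ℝ} (hR : 0 ≤ R) (he : ∀ k, 0 ≤ e k)
    (hsum : Summable fun k => e k ^ 2)
    (hv : ∀ n, v n ≤ e n * (1 + R * ∑ k ∈ Finset.range n, e k * v k)) (n : ℕ) :
    v n ≤ e n * Real.exp (R * ∑' k, e k ^ 2) := by
  set w : ℕ → ℝ := fun n => 1 + R * ∑ k ∈ Finset.range n, e k * v k with hw
  have w_succ_le : ∀ n, w (n + 1) ≤ (1 + R * e n ^ 2) * w n + 0 := fun n => by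
    have := mul_le_mul_of_nonneg_left (hv n) (mul_nonneg hR (he n))
    simp only [hw, Finset.sum_range_succ] at this ⊢
    linarith
  have w_le : w n ≤ Real.exp (R * ∑ k ∈ Finset.range n, e k ^ 2) := by
    simpa [hw, ← Finset.mul_sum, ← Finset.range_eq_Ico] using
      discrete_gronwall (n₀ := 0) (by simp [hw]) (fun n _ => w_succ_le n)
        (fun n _ => mul_nonneg hR (sq_nonneg _)) (fun _ _ => le_rfl) (Nat.zero_le n)
  refine (hv n).trans (mul_le_mul_of_nonneg_left (w_le.trans (Real.exp_le_exp.2 ?_)) (he n))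
  exact mul_le_mul_of_nonneg_left (hsum.sum_le_tsum _ fun k _ => sq_nonneg _) hR

lemma summable_add_sq {f g : ℕ → ℝ} (hf : Summable fun k => f k ^ 2)
    (hg : Summable fun k => g k ^ 2) : Summable fun k => (f k + g k) ^ 2 :=
  Summable.of_nonneg_of_le (fun _ => sq_nonneg _) (fun _ => add_sq_le) ((hf.add hg).mul_left 2)

lemma summable_mul_of_norm_le {e : ℕ → ℝ} {f g : ℕ → 𝕜} (he : Summable fun k => e k ^ 2)
    (hf : ∀ k, ‖f k‖ ≤ e k) (hg : ∀ k, ‖g k‖ ≤ e k) : Summable fun k => f k * g k :=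
  he.of_norm_bounded fun k => by
    rw [norm_mul, sq]
    exact mul_le_mul (hf k) (hg k) (norm_nonneg _) ((norm_nonneg _).trans (hf k))

lemma norm_sum_mul_le_tsum {e : ℕ → ℝ} {f g : ℕ → 𝕜} (he : Summable fun k => e k ^ 2)
    (hf : ∀ k, ‖f k‖ ≤ e k) (hg : ∀ k, ‖g k‖ ≤ e k) (n : ℕ) :
    ‖∑ k ∈ Finset.range n, f k * g k‖ ≤ ∑' k, e k ^ 2 := by
  refine (norm_sum_le_of_le _ fun k _ => ?_).trans (he.sum_le_tsum _ fun k _ => sq_nonneg _)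
  rw [norm_mul, sq]
  exact mul_le_mul (hf k) (hg k) (norm_nonneg _) ((norm_nonneg _).trans (hf k))

lemma norm_mul_sum_mul_le {e : ℕ → ℝ} {f g : ℕ → 𝕜} (hg : ∀ k, ‖g k‖ ≤ e k) (c : 𝕜) (n : ℕ) :
    ‖c * ∑ k ∈ Finset.range n, f k * g k‖ ≤ ‖c‖ * ∑ k ∈ Finset.range n, e k * ‖f k‖ := by
  rw [norm_mul]
  refine mul_le_mul_of_nonneg_left (norm_sum_le_of_le _ fun k _ => ?_) (norm_nonneg c)
  rw [norm_mul, mul_comm]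
  exact mul_le_mul_of_nonneg_right (hg k) (norm_nonneg _)

variable (𝕜) in
/-- Weyl's limit circle case: `(P_k(z))` and `(Q_k(z))` are square summable, with a common
square-summable majorant for `z` in any ball of `𝕜`. It characterizes indeterminacy. -/
def IsLimitCircle (s : ℕ → ℝ) : Prop :=
  ∀ R : ℝ, ∃ e : ℕ → ℝ, (Summable fun k => e k ^ 2) ∧
    ∀ z : 𝕜, ‖z‖ ≤ R → ∀ k, ‖evalP s z k‖ ≤ e k ∧ ‖evalQ s z k‖ ≤ e k

namespace IsPosDef

lemma norm_evalP_le (h : IsPosDef s) (z y : 𝕜) (n : ℕ) :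
    ‖evalP s z n‖ ≤ (‖evalP s y n‖ + ‖evalQ s y n‖) *
      (1 + ‖z - y‖ * ∑ k ∈ Finset.range n, (‖evalP s y k‖ + ‖evalQ s y k‖) * ‖evalP s z k‖) := by
  set S := ∑ k ∈ Finset.range n, (‖evalP s y k‖ + ‖evalQ s y k‖) * ‖evalP s z k‖
  have truncD_le : ‖truncD s n z y‖ ≤ ‖z - y‖ * S :=
    norm_mul_sum_mul_le (fun _ => le_add_of_nonneg_right (norm_nonneg _)) _ _
  have truncB_le : ‖truncB s n z y‖ ≤ 1 + ‖z - y‖ * S :=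
    (norm_add_le _ _).trans (add_le_add (by simp)
      (norm_mul_sum_mul_le (fun _ => le_add_of_nonneg_left (norm_nonneg _)) _ _))
  calc ‖evalP s z n‖ ≤ ‖truncD s n z y‖ * ‖evalQ s y n‖ + ‖truncB s n z y‖ * ‖evalP s y n‖ := by
        rw [h.evalP_eq_truncD_mul_sub n z y, ← norm_mul, ← norm_mul]
        exact norm_sub_le _ _
    _ ≤ (1 + ‖z - y‖ * S) * ‖evalQ s y n‖ + (1 + ‖z - y‖ * S) * ‖evalP s y n‖ := by
        gcongr
        exact truncD_le.trans (le_add_of_nonneg_left zero_le_one)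
    _ = _ := by ring

lemma norm_evalQ_le (h : IsPosDef s) (z y : 𝕜) (n : ℕ) :
    ‖evalQ s z n‖ ≤ (‖evalP s y n‖ + ‖evalQ s y n‖) *
      (1 + ‖z - y‖ * ∑ k ∈ Finset.range n, (‖evalP s y k‖ + ‖evalQ s y k‖) * ‖evalQ s z k‖) := by
  set S := ∑ k ∈ Finset.range n, (‖evalP s y k‖ + ‖evalQ s y k‖) * ‖evalQ s z k‖
  have truncC_le : ‖truncC s n z y‖ ≤ 1 + ‖z - y‖ * S :=
    (norm_add_le _ _).trans (add_le_add (by simp)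
      (norm_mul_sum_mul_le (fun _ => le_add_of_nonneg_right (norm_nonneg _)) _ _))
  have truncA_le : ‖truncA s n z y‖ ≤ ‖z - y‖ * S :=
    norm_mul_sum_mul_le (fun _ => le_add_of_nonneg_left (norm_nonneg _)) _ _
  calc ‖evalQ s z n‖ ≤ ‖truncC s n z y‖ * ‖evalQ s y n‖ + ‖truncA s n z y‖ * ‖evalP s y n‖ := by
        rw [h.evalQ_eq_truncC_mul_sub n z y, ← norm_mul, ← norm_mul]
        exact norm_sub_le _ _
    _ ≤ (1 + ‖z - y‖ * S) * ‖evalQ s y n‖ + (1 + ‖z - y‖ * S) * ‖evalP s y n‖ := by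
        gcongr
        exact truncA_le.trans (le_add_of_nonneg_left zero_le_one)
    _ = _ := by ring

lemma isLimitCircle_of_summable (h : IsPosDef s) {y : 𝕜}
    (hP : Summable fun k => ‖evalP s y k‖ ^ 2) (hQ : Summable fun k => ‖evalQ s y k‖ ^ 2) :
    IsLimitCircle 𝕜 s := by
  intro R
  set e : ℕ → ℝ := fun k => ‖evalP s y k‖ + ‖evalQ s y k‖
  have e_nonneg : ∀ k, 0 ≤ e k := fun k => by positivity
  have summable_e : Summable fun k => e k ^ 2 := summable_add_sq hP hQ
  refine ⟨fun k => e k * Real.exp ((R + ‖y‖) * ∑' k, e k ^ 2), ?_, fun z hz k => ?_⟩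
  · simpa only [mul_pow] using summable_e.mul_right _
  · have exp_le : Real.exp (‖z - y‖ * ∑' k, e k ^ 2) ≤ Real.exp ((R + ‖y‖) * ∑' k, e k ^ 2) := by
      refine Real.exp_le_exp.2 (mul_le_mul_of_nonneg_right ?_ (tsum_nonneg fun k => sq_nonneg _))
      exact (norm_sub_le _ _).trans (add_le_add_left hz _)
    exact ⟨(le_mul_exp_of_le_mul_one_add_sum (norm_nonneg _) e_nonneg summable_e
        (h.norm_evalP_le z y) k).trans (mul_le_mul_of_nonneg_left exp_le (e_nonneg k)),
      (le_mul_exp_of_le_mul_one_add_sum (norm_nonneg _) e_nonneg summable_e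
        (h.norm_evalQ_le z y) k).trans (mul_le_mul_of_nonneg_left exp_le (e_nonneg k))⟩

end IsPosDef

namespace IsLimitCircle

lemma real (hL : IsLimitCircle ℂ s) : IsLimitCircle ℝ s := by
  intro R
  obtain ⟨e, he, bound⟩ := hL R
  refine ⟨e, he, fun x hx k => ?_⟩
  have norm_aeval_ofReal (p : ℝ[X]) : ‖aeval (x : ℂ) p‖ = ‖aeval x p‖ := by
    rw [← Complex.coe_algebraMap, aeval_algebraMap_apply, norm_algebraMap']
  simpa only [norm_aeval_ofReal] using bound x (by rwa [Complex.norm_real]) k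

lemma exists_common_majorant (hL : IsLimitCircle 𝕜 s) (u v : 𝕜) :
    ∃ e : ℕ → ℝ, (Summable fun k => e k ^ 2) ∧
      ((∀ k, ‖evalP s u k‖ ≤ e k) ∧ ∀ k, ‖evalQ s u k‖ ≤ e k) ∧
      (∀ k, ‖evalP s v k‖ ≤ e k) ∧ ∀ k, ‖evalQ s v k‖ ≤ e k := by
  obtain ⟨e, he, bound⟩ := hL (max ‖u‖ ‖v‖)
  exact ⟨e, he, forall_and.1 (bound u (le_max_left _ _)), forall_and.1 (bound v (le_max_right _ _))⟩

lemma tendsto_truncA (hL : IsLimitCircle 𝕜 s) (u v : 𝕜) :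
    Tendsto (fun n => truncA s n u v) atTop
      (𝓝 ((u - v) * ∑' k, evalQ s u k * evalQ s v k)) := by
  obtain ⟨e, he, ⟨-, hu⟩, -, hv⟩ := hL.exists_common_majorant u v
  exact (summable_mul_of_norm_le he hu hv).hasSum.tendsto_sum_nat.const_mul _

lemma tendsto_truncB (hL : IsLimitCircle 𝕜 s) (u v : 𝕜) :
    Tendsto (fun n => truncB s n u v) atTop
      (𝓝 (-1 + (u - v) * ∑' k, evalP s u k * evalQ s v k)) := by
  obtain ⟨e, he, ⟨hu, -⟩, -, hv⟩ := hL.exists_common_majorant u v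
  exact ((summable_mul_of_norm_le he hu hv).hasSum.tendsto_sum_nat.const_mul _).const_add _

lemma tendsto_truncC (hL : IsLimitCircle 𝕜 s) (u v : 𝕜) :
    Tendsto (fun n => truncC s n u v) atTop
      (𝓝 (1 + (u - v) * ∑' k, evalQ s u k * evalP s v k)) := by
  obtain ⟨e, he, ⟨-, hu⟩, hv, -⟩ := hL.exists_common_majorant u v
  exact ((summable_mul_of_norm_le he hu hv).hasSum.tendsto_sum_nat.const_mul _).const_add _

lemma tendsto_truncD (hL : IsLimitCircle 𝕜 s) (u v : 𝕜) :
    Tendsto (fun n => truncD s n u v) atTop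
      (𝓝 ((u - v) * ∑' k, evalP s u k * evalP s v k)) := by
  obtain ⟨e, he, ⟨hu, -⟩, hv, -⟩ := hL.exists_common_majorant u v
  exact (summable_mul_of_norm_le he hu hv).hasSum.tendsto_sum_nat.const_mul _

variable {u : ℕ → 𝕜} {v : 𝕜}

lemma exists_majorant_of_tendsto (hL : IsLimitCircle 𝕜 s) (hu : Tendsto u atTop (𝓝 v)) :
    ∃ e : ℕ → ℝ, (Summable fun k => e k ^ 2) ∧ (∀ᶠ n in atTop, ∀ k, ‖evalP s (u n) k‖ ≤ e k) ∧
      (∀ k, ‖evalP s v k‖ ≤ e k) ∧ ∀ k, ‖evalQ s v k‖ ≤ e k := by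
  obtain ⟨e, he, bound⟩ := hL (‖v‖ + 1)
  refine ⟨e, he, ?_, forall_and.1 (bound v (by linarith))⟩
  filter_upwards [hu.norm.eventually_le_const (lt_add_one ‖v‖)] with n hn k
  exact (bound _ hn k).1

lemma tendsto_truncB_of_tendsto (hL : IsLimitCircle 𝕜 s) (hu : Tendsto u atTop (𝓝 v)) :
    Tendsto (fun n => truncB s n (u n) v) atTop (𝓝 (-1)) := by
  obtain ⟨e, he, hPu, -, hQ⟩ := hL.exists_majorant_of_tendsto hu
  have tendsto_mul_sum := (tendsto_sub_nhds_zero_iff.2 hu).zero_mul_isBoundedUnder_le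
    (g := fun n => ∑ k ∈ Finset.range n, evalP s (u n) k * evalQ s v k)
    ⟨_, eventually_map.2 (hPu.mono fun n hn => norm_sum_mul_le_tsum he hn hQ n)⟩
  simpa only [truncB, add_zero] using tendsto_mul_sum.const_add (-1)

lemma tendsto_truncD_of_tendsto (hL : IsLimitCircle 𝕜 s) (hu : Tendsto u atTop (𝓝 v)) :
    Tendsto (fun n => truncD s n (u n) v) atTop (𝓝 0) := by
  obtain ⟨e, he, hPu, hP, -⟩ := hL.exists_majorant_of_tendsto hu
  exact (tendsto_sub_nhds_zero_iff.2 hu).zero_mul_isBoundedUnder_le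
    ⟨_, eventually_map.2 (hPu.mono fun n hn => norm_sum_mul_le_tsum he hn hP n)⟩

end IsLimitCircle

/-! ### The Stieltjes transform -/

/-- The Stieltjes transform `∫ dμ(x) / (x - z)`, for `z` in `ℝ` or `ℂ`. -/
def stieltjes (μ : Measure ℝ) (z : 𝕜) : 𝕜 := ∫ x : ℝ, 1 / ((x : 𝕜) - z) ∂μ

lemma stieltjes_ofReal (μ : Measure ℝ) (y : ℝ) : stieltjes μ (y : 𝕜) = (stieltjes μ y : ℝ) := by
  rw [stieltjes, stieltjes, ← integral_ofReal]
  simp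

lemma abs_im_le_norm_ofReal_sub (z : ℂ) (x : ℝ) : |z.im| ≤ ‖(x : ℂ) - z‖ := by
  simpa using Complex.abs_im_le_norm ((x : ℂ) - z)

lemma norm_one_div_ofReal_sub_le {z : ℂ} (hz : z.im ≠ 0) (x : ℝ) :
    ‖1 / ((x : ℂ) - z)‖ ≤ 1 / |z.im| := by
  rw [norm_div, norm_one]
  exact one_div_le_one_div_of_le (abs_pos.2 hz) (abs_im_le_norm_ofReal_sub z x)

lemma norm_stieltjes_le (μ : Measure ℝ) [IsProbabilityMeasure μ] {z : ℂ} (hz : z.im ≠ 0) :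
    ‖stieltjes μ z‖ ≤ 1 / |z.im| :=
  (norm_integral_le_of_norm_le_const (.of_forall (norm_one_div_ofReal_sub_le hz))).trans (by simp)

section ResolventIntegrable

variable {μ : Measure ℝ} [IsFiniteMeasure μ]

lemma integrable_one_div_sub_of_le_norm {z : 𝕜} {δ : ℝ} (hδ : 0 < δ)
    (hz : ∀ᵐ x : ℝ ∂μ, δ ≤ ‖(x : 𝕜) - z‖) : Integrable (fun x : ℝ => 1 / ((x : 𝕜) - z)) μ := by
  refine Integrable.of_bound
    (measurable_const.div (RCLike.measurable_ofReal.sub_const z)).aestronglyMeasurable (1 / δ) ?_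
  filter_upwards [hz] with x hx
  rw [norm_div, norm_one]
  exact one_div_le_one_div_of_le hδ hx

lemma integrable_one_div_sub_of_im_ne_zero {z : ℂ} (hz : z.im ≠ 0) :
    Integrable (fun x : ℝ => 1 / ((x : ℂ) - z)) μ :=
  integrable_one_div_sub_of_le_norm (abs_pos.2 hz) (.of_forall (abs_im_le_norm_ofReal_sub z))

lemma integrable_one_div_sub_of_lt {p y : ℝ} (hy : y < p) (hp : ∀ᵐ x ∂μ, p ≤ x) :
    Integrable (fun x => 1 / (x - y)) μ := by
  refine integrable_one_div_sub_of_le_norm (𝕜 := ℝ) (sub_pos.2 hy) ?_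
  filter_upwards [hp] with x hx using (sub_le_sub_right hx y).trans (le_abs_self _)

lemma differentiableOn_stieltjes {U : Set ℂ} (hU : IsOpen U) (hμ : ∀ᵐ x : ℝ ∂μ, (x : ℂ) ∉ U) :
    DifferentiableOn ℂ (stieltjes μ) U := by
  intro z₀ hz₀
  obtain ⟨δ, hδ, ball_subset⟩ := Metric.isOpen_iff.1 hU z₀ hz₀
  have le_norm_sub : ∀ᵐ x : ℝ ∂μ, ∀ z ∈ Metric.ball z₀ (δ / 2), δ / 2 ≤ ‖(x : ℂ) - z‖ := by
    filter_upwards [hμ] with x hx z hz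
    have le_dist : δ ≤ dist (x : ℂ) z₀ := not_lt.1 fun h => hx (ball_subset h)
    rw [← dist_eq_norm]
    linarith [dist_triangle (x : ℂ) z z₀, Metric.mem_ball.1 hz]
  have measurable_sub (z : ℂ) : Measurable fun x : ℝ => (x : ℂ) - z := by fun_prop
  refine (hasDerivAt_integral_of_dominated_loc_of_deriv_le
    (F' := fun z (x : ℝ) => 1 / ((x : ℂ) - z) ^ 2) (bound := fun _ => 1 / (δ / 2) ^ 2)
    (Metric.ball_mem_nhds z₀ (half_pos hδ))
    (.of_forall fun z => (measurable_const.div (measurable_sub z)).aestronglyMeasurable)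
    (integrable_one_div_sub_of_le_norm (half_pos hδ)
      (le_norm_sub.mono fun x hx => hx z₀ (Metric.mem_ball_self (half_pos hδ))))
    (measurable_const.div ((measurable_sub z₀).pow_const 2)).aestronglyMeasurable ?_
    (integrable_const _) ?_).2.differentiableAt.differentiableWithinAt
  · filter_upwards [le_norm_sub] with x hx z hz
    rw [norm_div, norm_one, norm_pow]
    exact one_div_le_one_div_of_le (by positivity) (pow_le_pow_left₀ (by positivity) (hx z hz) 2)
  · filter_upwards [le_norm_sub] with x hx z hz
    have sub_ne_zero : (x : ℂ) - z ≠ 0 := norm_pos_iff.1 ((half_pos hδ).trans_le (hx z hz))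
    simpa using ((hasDerivAt_id z).const_sub (x : ℂ)).fun_inv sub_ne_zero

end ResolventIntegrable

lemma integrable_exp_neg_abs : Integrable fun u : ℝ => Real.exp (-|u|) := by
  rw [← integrableOn_univ, ← Set.Iic_union_Ioi (a := (0 : ℝ))]
  refine .union ?_ ?_
  · refine (integrableOn_exp_Iic 0).congr_fun (fun u hu => ?_) measurableSet_Iic
    rw [abs_of_nonpos hu, neg_neg]
  · refine (integrableOn_exp_neg_Ioi 0).congr_fun (fun u hu => ?_) measurableSet_Ioi
    rw [abs_of_pos hu]

lemma norm_exp_neg_abs_mul_cexp (u x : ℝ) :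
    ‖(Real.exp (-|u|) : ℂ) * Complex.exp (u * x * Complex.I)‖ = Real.exp (-|u|) := by
  rw [norm_mul, Complex.norm_real, Real.norm_of_nonneg (Real.exp_pos _).le, ← Complex.ofReal_mul,
    Complex.norm_exp_ofReal_mul_I, mul_one]

lemma integral_exp_neg_abs_mul_cexp (x : ℝ) :
    ∫ u : ℝ, (Real.exp (-|u|) : ℂ) * Complex.exp (u * x * Complex.I) =
      Complex.I * (1 / (x + Complex.I) - 1 / (x - Complex.I)) := by
  have integrable_mul : Integrable fun u : ℝ =>
      (Real.exp (-|u|) : ℂ) * Complex.exp (u * x * Complex.I) :=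
    integrable_exp_neg_abs.mono' (by fun_prop) <| .of_forall fun u =>
      (norm_exp_neg_abs_mul_cexp u x).le
  have integral_Iic : ∫ u : ℝ in Set.Iic 0, (Real.exp (-|u|) : ℂ) * Complex.exp (u * x * Complex.I)
      = 1 / (1 + x * Complex.I) := by
    rw [setIntegral_congr_fun (g := fun u : ℝ => Complex.exp ((1 + x * Complex.I) * u))
      measurableSet_Iic fun u hu => ?_, integral_exp_mul_complex_Iic (by simp)]
    · simp
    · rw [abs_of_nonpos hu, Complex.ofReal_exp, ← Complex.exp_add]
      push_cast
      ring_nf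
  have integral_Ioi : ∫ u : ℝ in Set.Ioi 0, (Real.exp (-|u|) : ℂ) * Complex.exp (u * x * Complex.I)
      = 1 / (1 - x * Complex.I) := by
    rw [setIntegral_congr_fun (g := fun u : ℝ => Complex.exp ((-1 + x * Complex.I) * u))
      measurableSet_Ioi fun u hu => ?_, integral_exp_mul_complex_Ioi (by simp)]
    · rw [show -1 + x * Complex.I = -(1 - x * Complex.I) by ring]
      simp only [Complex.ofReal_zero, mul_zero, Complex.exp_zero, neg_div_neg_eq]
    · rw [abs_of_pos hu, Complex.ofReal_exp, ← Complex.exp_add]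
      push_cast
      ring_nf
  rw [← intervalIntegral.integral_Iic_add_Ioi integrable_mul.integrableOn
    integrable_mul.integrableOn, integral_Iic, integral_Ioi]
  have one_add_eq : 1 + x * Complex.I = Complex.I * (x - Complex.I) := by
    linear_combination Complex.I_mul_I
  have one_sub_eq : 1 - x * Complex.I = -Complex.I * (x + Complex.I) := by
    linear_combination Complex.I_mul_I
  rw [one_add_eq, one_sub_eq]
  simp only [one_div, mul_inv, Complex.inv_I, inv_neg]
  ring

lemma fourier_exp_neg_abs_mul_charFun (μ : Measure ℝ) [IsFiniteMeasure μ] (w : ℝ) :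
    FourierTransform.fourier (fun u : ℝ => (Real.exp (-|u|) : ℂ) * charFun μ u) w =
      Complex.I * (stieltjes μ (2 * Real.pi * w - Complex.I : ℂ) -
        stieltjes μ (2 * Real.pi * w + Complex.I : ℂ)) := by
  set f : ℝ → ℝ → ℂ := fun u x =>
    (Real.exp (-|u|) : ℂ) * Complex.exp (u * (x - 2 * Real.pi * w : ℝ) * Complex.I)
  have integrable_f : Integrable (Function.uncurry f) (volume.prod μ) := by
    refine (integrable_exp_neg_abs.mul_prod (integrable_const (1 : ℝ))).mono' (by fun_prop)
      (.of_forall fun q => ?_)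
    rw [Function.uncurry_def, norm_exp_neg_abs_mul_cexp, mul_one]
  calc FourierTransform.fourier (fun u : ℝ => (Real.exp (-|u|) : ℂ) * charFun μ u) w
      = ∫ u : ℝ, ∫ x, f u x ∂μ := by
        rw [Real.fourier_real_eq_integral_exp_smul]
        refine integral_congr_ae (.of_forall fun u => ?_)
        simp only [charFun_apply_real, smul_eq_mul, ← integral_const_mul, f]
        refine integral_congr_ae (.of_forall fun x => ?_)
        simp only [mul_left_comm (Complex.exp _), ← Complex.exp_add]
        push_cast
        ring_nf
    _ = ∫ x, Complex.I * (1 / (x - (2 * Real.pi * w - Complex.I)) -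
          1 / (x - (2 * Real.pi * w + Complex.I))) ∂μ := by
        rw [integral_integral_swap integrable_f]
        refine integral_congr_ae (.of_forall fun x => ?_)
        simp only [f, integral_exp_neg_abs_mul_cexp]
        push_cast
        ring_nf
    _ = _ := by
        rw [integral_const_mul, integral_sub (integrable_one_div_sub_of_im_ne_zero (by simp))
          (integrable_one_div_sub_of_im_ne_zero (by simp))]
        rfl

lemma ext_of_stieltjes_eq {μ ν : Measure ℝ} [IsFiniteMeasure μ] [IsFiniteMeasure ν]
    (h : ∀ z : ℂ, z.im ≠ 0 → stieltjes μ z = stieltjes ν z) : μ = ν := by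
  set f : Measure ℝ → ℝ → ℂ := fun m u => (Real.exp (-|u|) : ℂ) * charFun m u
  have continuous_f (m : Measure ℝ) [IsFiniteMeasure m] : Continuous (f m) :=
    (by fun_prop : Continuous fun u : ℝ => (Real.exp (-|u|) : ℂ)).mul continuous_charFun
  have integrable_f (m : Measure ℝ) [IsFiniteMeasure m] : Integrable (f m) := by
    refine (integrable_exp_neg_abs.mul_const (m.real Set.univ)).mono'
      (continuous_f m).aestronglyMeasurable (.of_forall fun u => ?_)
    rw [norm_mul, Complex.norm_real, Real.norm_of_nonneg (Real.exp_pos _).le]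
    exact mul_le_mul_of_nonneg_left (norm_charFun_le u) (Real.exp_pos _).le
  have fourier_sub : FourierTransform.fourier (f μ - f ν) = 0 := by
    ext w
    simp only [Real.fourier_eq, Pi.sub_apply, smul_sub]
    rw [integral_sub ((Real.fourierIntegral_convergent_iff w).2 (integrable_f μ))
      ((Real.fourierIntegral_convergent_iff w).2 (integrable_f ν)), ← Real.fourier_eq,
      ← Real.fourier_eq, fourier_exp_neg_abs_mul_charFun, fourier_exp_neg_abs_mul_charFun,
      h _ (by simp), h _ (by simp), sub_self, Pi.zero_apply]
  have f_eq : f μ - f ν = 0 := by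
    rw [← ((continuous_f μ).sub (continuous_f ν)).fourierInv_fourier_eq
      ((integrable_f μ).sub (integrable_f ν)) (fourier_sub ▸ integrable_zero _ _ _),
      fourier_sub]
    ext u
    simp [Real.fourierInv_eq]
  refine Measure.ext_of_charFun (funext fun u => ?_)
  exact mul_left_cancel₀ (Complex.ofReal_ne_zero.2 (Real.exp_pos _).ne')
    (congrFun (sub_eq_zero.1 f_eq) u)

lemma ext_of_stieltjes_eq_of_lt {μ ν : Measure ℝ} [IsFiniteMeasure μ] [IsFiniteMeasure ν] {p : ℝ}
    (hμ : ∀ᵐ x ∂μ, p ≤ x) (hν : ∀ᵐ x ∂ν, p ≤ x)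
    (h : ∀ y < p, stieltjes μ y = stieltjes ν y) : μ = ν := by
  set U : Set ℂ := (fun z : ℂ => p - z) ⁻¹' Complex.slitPlane
  have mem_U {z : ℂ} : z ∈ U ↔ z.re < p ∨ z.im ≠ 0 := by
    simp [U, Complex.mem_slitPlane_iff]
  have isOpen_U : IsOpen U := Complex.isOpen_slitPlane.preimage (by fun_prop)
  have isPreconnected_U : IsPreconnected U := by
    have : U = (fun z : ℂ => p - z) '' Complex.slitPlane := by
      ext z
      exact ⟨fun hz => ⟨p - z, hz, by simp⟩, by rintro ⟨w, hw, rfl⟩; simpa [U] using hw⟩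
    rw [this]
    exact (Complex.starConvex_one_slitPlane.isPathConnected
      Complex.one_mem_slitPlane).isConnected.isPreconnected.image _ (by fun_prop)
  have analytic (m : Measure ℝ) [IsFiniteMeasure m] (hm : ∀ᵐ x ∂m, p ≤ x) :
      AnalyticOnNhd ℂ (stieltjes m) U :=
    (differentiableOn_stieltjes isOpen_U (hm.mono fun x hx => by simpa [mem_U])).analyticOnNhd
      isOpen_U
  have frequently_eq : ∃ᶠ z : ℂ in 𝓝[≠] ((p - 1 : ℝ) : ℂ), stieltjes μ z = stieltjes ν z := by
    have : Tendsto ((↑) : ℝ → ℂ) (𝓝[<] (p - 1)) (𝓝[≠] ((p - 1 : ℝ) : ℂ)) :=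
      tendsto_nhdsWithin_iff.2 ⟨Complex.continuous_ofReal.continuousWithinAt, by
        filter_upwards [self_mem_nhdsWithin] with y hy
        exact Complex.ofReal_injective.ne (ne_of_lt hy)⟩
    refine this.frequently (Eventually.frequently ?_)
    filter_upwards [self_mem_nhdsWithin] with y hy
    rw [Set.mem_Iio] at hy
    exact (stieltjes_ofReal μ y).trans ((congrArg _ (h y (by linarith))).trans
      (stieltjes_ofReal ν y).symm)
  refine ext_of_stieltjes_eq fun z hz => ?_
  exact (analytic μ hμ).eqOn_of_preconnected_of_frequently_eq (analytic ν hν) isPreconnected_U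
    (mem_U.2 (.inl (by simp))) frequently_eq (mem_U.2 (.inr hz))

/-! ### Solutions and quadratures -/

/-- `μ` integrates every polynomial, and reproduces the moment functional of `s` on polynomials of
degree less than `N`. This covers solutions (for every `N`) and the `n`-point Gauss quadrature
(for `N = 2 * n`). -/
structure IsExactBelow (s : ℕ → ℝ) (N : ℕ) (μ : Measure ℝ) : Prop where
  integrable_eval : ∀ q : ℝ[X], Integrable (fun x => q.eval x) μ
  integral_eval : ∀ q : ℝ[X], q.degree < N → ∫ x, q.eval x ∂μ = momentFunctional s q

lemma IsExactBelow.mono {μ : Measure ℝ} {M N : ℕ} (hμ : IsExactBelow s N μ) (hMN : M ≤ N) :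
    IsExactBelow s M μ where
  integrable_eval := hμ.integrable_eval
  integral_eval q hq := hμ.integral_eval q (hq.trans_le (by exact_mod_cast hMN))

namespace IsHamburgerSolution

variable {μ ν : Measure ℝ}

lemma integrable_eval (hμ : IsHamburgerSolution s μ) (q : ℝ[X]) :
    Integrable (fun x => q.eval x) μ := by
  simp only [eval_eq_sum_range]
  exact integrable_finsetSum _ fun n _ => (hμ.integrable_pow n).const_mul _

lemma integral_eval (hμ : IsHamburgerSolution s μ) (q : ℝ[X]) :
    ∫ x, q.eval x ∂μ = momentFunctional s q := by
  conv_rhs => rw [q.as_sum_range_C_mul_X_pow]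
  simp only [eval_eq_sum_range, map_sum, momentFunctional_C_mul, momentFunctional_X_pow,
    integral_finsetSum _ fun n _ => (hμ.integrable_pow n).const_mul (q.coeff n),
    integral_const_mul, hμ.integral_pow]

lemma isExactBelow (hμ : IsHamburgerSolution s μ) (N : ℕ) : IsExactBelow s N μ :=
  ⟨hμ.integrable_eval, fun q _ => hμ.integral_eval q⟩

lemma ae_mem_roots_of_momentFunctional_sq_eq_zero (hμ : IsHamburgerSolution s μ) {q : ℝ[X]}
    (hq : q ≠ 0) (h0 : momentFunctional s (q * q) = 0) : ∀ᵐ x ∂μ, x ∈ q.roots.toFinset := by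
  rw [← hμ.integral_eval, integral_eq_zero_iff_of_nonneg_ae (.of_forall fun x => ?_)
    (hμ.integrable_eval _)] at h0
  · filter_upwards [h0] with x hx
    rw [Multiset.mem_toFinset, mem_roots hq]
    simpa using hx
  · rw [eval_mul]
    exact mul_self_nonneg _

lemma eq_of_momentFunctional_sq_eq_zero (hμ : IsHamburgerSolution s μ)
    (hν : IsHamburgerSolution s ν) {q : ℝ[X]} (hq : q ≠ 0)
    (h0 : momentFunctional s (q * q) = 0) : μ = ν := by
  have := hμ.isProbabilityMeasure
  have := hν.isProbabilityMeasure
  have integral_eq (f : ℝ → ℝ) {m : Measure ℝ} (hm : IsHamburgerSolution s m) :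
      ∫ x, f x ∂m = momentFunctional s (Lagrange.interpolate q.roots.toFinset id f) := by
    rw [← hm.integral_eval]
    refine integral_congr_ae ?_
    filter_upwards [hm.ae_mem_roots_of_momentFunctional_sq_eq_zero hq h0] with x hx
    exact (Lagrange.eval_interpolate_at_node (v := id) f Function.injective_id.injOn hx).symm
  exact ext_of_forall_integral_eq_of_IsFiniteMeasure fun f =>
    (integral_eq f hμ).trans (integral_eq f hν).symm

lemma isPosDef_of_ne (hμ : IsHamburgerSolution s μ) (hν : IsHamburgerSolution s ν)
    (hne : μ ≠ ν) : IsPosDef s where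
  map_one := by
    have := hμ.isProbabilityMeasure
    simpa using (hμ.integral_eval 1).symm
  pos q hq := by
    refine lt_of_le_of_ne ?_ fun h0 => hne (hμ.eq_of_momentFunctional_sq_eq_zero hν hq h0.symm)
    rw [← hμ.integral_eval]
    refine integral_nonneg fun x => ?_
    rw [eval_mul]
    exact mul_self_nonneg _

end IsHamburgerSolution

lemma ae_le_iff_support_subset {μ : Measure ℝ} {p : ℝ} :
    (∀ᵐ x ∂μ, p ≤ x) ↔ μ.support ⊆ Set.Ici p := by
  refine ⟨fun h => Measure.support_subset_of_isClosed isClosed_Ici h, fun h => ?_⟩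
  filter_upwards [Measure.support_mem_ae (μ := μ)] with x hx using h hx

lemma coe_le_infSupport_iff {μ : Measure ℝ} {p : ℝ} :
    (p : EReal) ≤ infSupport μ ↔ ∀ᵐ x ∂μ, p ≤ x := by
  rw [ae_le_iff_support_subset, infSupport, le_sInf_iff]
  simp [Set.subset_def]

/-! ### Zeros and Gauss quadrature -/

/-- The zeros of `P_n`, which are the nodes of the `n`-point Gauss quadrature. -/
def nodes (s : ℕ → ℝ) (n : ℕ) : Finset ℝ := (orthP s n).roots.toFinset

/-- The weight of the `n`-point Gauss quadrature at the node `r`. -/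
def gaussWeight (s : ℕ → ℝ) (n : ℕ) (r : ℝ) : ℝ :=
  momentFunctional s (Lagrange.basis (nodes s n) id r)

/-- The `n`-point Gauss quadrature of `s`, as a discrete measure. -/
def gaussMeasure (s : ℕ → ℝ) (n : ℕ) : Measure ℝ :=
  ∑ r ∈ nodes s n, ENNReal.ofReal (gaussWeight s n r) • Measure.dirac r

lemma ae_mem_nodes_gaussMeasure (s : ℕ → ℝ) (n : ℕ) :
    ∀ᵐ x ∂(gaussMeasure s n), x ∈ nodes s n := by
  rw [ae_iff, gaussMeasure, Measure.finsetSum_apply]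
  exact Finset.sum_eq_zero fun r hr => by simp [hr]

instance (s : ℕ → ℝ) (n : ℕ) : IsFiniteMeasure (gaussMeasure s n) where
  measure_univ_lt_top := by simp [gaussMeasure, Measure.finsetSum_apply, ENNReal.sum_lt_top]

lemma integrable_gaussMeasure {F : Type*} [NormedAddCommGroup F] (s : ℕ → ℝ) (n : ℕ)
    (f : ℝ → F) : Integrable f (gaussMeasure s n) := by
  rw [gaussMeasure, integrable_finsetSum_measure]
  exact fun r _ => (integrable_dirac (by simp)).smul_measure ENNReal.ofReal_ne_top

namespace IsPosDef

lemma degree_lt_of_orthP_eq_mul (h : IsPosDef s) {n : ℕ} {m q : ℝ[X]} (hm : m.natDegree ≠ 0)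
    (hmq : orthP s n = m * q) : q.degree < n := by
  have hne := hmq ▸ h.orthP_ne_zero n
  have hdeg := h.natDegree_orthP n
  rw [hmq, natDegree_mul (left_ne_zero_of_mul hne) (right_ne_zero_of_mul hne)] at hdeg
  rw [degree_eq_natDegree (right_ne_zero_of_mul hne)]
  exact_mod_cast (by omega)

lemma not_sq_add_C_dvd_orthP (h : IsPosDef s) (n : ℕ) (a : ℝ) {c : ℝ} (hc : 0 ≤ c) :
    ¬ (X - C a) ^ 2 + C c ∣ orthP s n := by
  rintro ⟨q, hq⟩
  have hq0 : q ≠ 0 := right_ne_zero_of_mul (hq ▸ h.orthP_ne_zero n)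
  have natDegree_eq : ((X - C a) ^ 2 + C c).natDegree = 2 := by compute_degree!
  have eq_zero := h.momentFunctional_orthP_mul_of_degree_lt
    (h.degree_lt_of_orthP_eq_mul (by rw [natDegree_eq]; exact two_ne_zero) hq)
  have eq_sum_sq : orthP s n * q = (X - C a) * q * ((X - C a) * q) + C c * (q * q) := by
    rw [hq]; ring
  rw [eq_sum_sq, map_add, momentFunctional_C_mul] at eq_zero
  linarith [h.pos _ (mul_ne_zero (X_sub_C_ne_zero a) hq0), mul_nonneg hc (h.pos _ hq0).le]

lemma splits_orthP (h : IsPosDef s) (n : ℕ) : (orthP s n).Splits := by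
  refine Splits.of_splits_map (algebraMap ℝ ℂ) (IsAlgClosed.splits _) fun z hz => ?_
  by_contra not_real
  have him : z.im ≠ 0 := fun h0 => not_real ⟨z.re, Complex.ext rfl (by simp [h0])⟩
  have eval_eq_zero : aeval z (orthP s n) = 0 := by
    simpa only [IsRoot.def, eval_map_algebraMap] using (mem_roots'.1 hz).2
  have dvd := quadratic_dvd_of_aeval_eq_zero_im_ne_zero _ eval_eq_zero him
  refine h.not_sq_add_C_dvd_orthP n z.re (sq_nonneg z.im) ?_
  convert dvd using 1
  rw [Complex.sq_norm, Complex.normSq_apply]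
  simp only [C_mul, C_add, C_pow, C_ofNat]
  ring

lemma nodup_roots_orthP (h : IsPosDef s) (n : ℕ) : (orthP s n).roots.Nodup := by
  rw [Multiset.nodup_iff_count_le_one]
  intro r
  rw [count_roots]
  by_contra! one_lt
  have dvd := (le_rootMultiplicity_iff (h.orthP_ne_zero n)).1 one_lt
  exact h.not_sq_add_C_dvd_orthP n r le_rfl (by simpa using dvd)

lemma mem_nodes (h : IsPosDef s) {n : ℕ} {x : ℝ} : x ∈ nodes s n ↔ (orthP s n).eval x = 0 := by
  rw [nodes, Multiset.mem_toFinset, mem_roots (h.orthP_ne_zero n), IsRoot.def]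

lemma card_nodes (h : IsPosDef s) (n : ℕ) : (nodes s n).card = n := by
  rw [nodes, Multiset.toFinset_card_of_nodup (h.nodup_roots_orthP n),
    ← (h.splits_orthP n).natDegree_eq_card_roots, h.natDegree_orthP]

lemma neg_one_pow_mul_eval_orthP_pos (h : IsPosDef s) {n : ℕ} {y : ℝ}
    (hy : ∀ r ∈ nodes s n, y < r) : 0 < (-1) ^ n * (orthP s n).eval y := by
  have neg_one_pow_eq : (-1 : ℝ) ^ n = ((orthP s n).roots.map fun _ => (-1 : ℝ)).prod := by
    rw [Multiset.map_const', Multiset.prod_replicate, ← (h.splits_orthP n).natDegree_eq_card_roots,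
      h.natDegree_orthP]
  rw [(h.splits_orthP n).eval_eq_prod_roots, mul_left_comm, neg_one_pow_eq,
    ← Multiset.prod_map_mul]
  refine mul_pos (h.leadingCoeff_orthP_pos n) (Multiset.prod_pos ?_)
  simp only [Multiset.mem_map, forall_exists_index, and_imp, forall_apply_eq_imp_iff₂]
  intro r hr
  linarith [hy r (Multiset.mem_toFinset.2 hr)]

lemma degree_div_orthP_lt (h : IsPosDef s) {n : ℕ} {q : ℝ[X]} (hq : q.degree < (2 * n : ℕ)) :
    (q / orthP s n).degree < n := by
  rcases eq_or_ne (q / orthP s n) 0 with h0 | h0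
  · rw [h0, degree_zero]
    exact WithBot.bot_lt_coe n
  have degree_le : (orthP s n).degree ≤ q.degree :=
    not_lt.1 fun hlt => h0 ((Polynomial.div_eq_zero_iff (h.orthP_ne_zero n)).2 hlt)
  rw [← degree_add_div (h.orthP_ne_zero n) degree_le, h.degree_orthP, degree_eq_natDegree h0] at hq
  rw [degree_eq_natDegree h0]
  norm_cast at hq ⊢
  omega

lemma momentFunctional_eq_sum_gaussWeight (h : IsPosDef s) {n : ℕ} {q : ℝ[X]}
    (hq : q.degree < (2 * n : ℕ)) :
    momentFunctional s q = ∑ r ∈ nodes s n, gaussWeight s n r * q.eval r := by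
  have div_add_mod : orthP s n * (q / orthP s n) + q % orthP s n = q :=
    EuclideanDomain.div_add_mod _ _
  have degree_mod_lt : (q % orthP s n).degree < (nodes s n).card := by
    rw [h.card_nodes, ← h.degree_orthP n]
    exact degree_mod_lt _ (h.orthP_ne_zero n)
  have eval_mod : ∀ r ∈ nodes s n, (q % orthP s n).eval r = q.eval r := fun r hr => by
    conv_rhs => rw [← div_add_mod, eval_add, eval_mul, h.mem_nodes.1 hr, zero_mul, zero_add]
  have map_mod : momentFunctional s q = momentFunctional s (q % orthP s n) := by
    conv_lhs => rw [← div_add_mod, map_add,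
      h.momentFunctional_orthP_mul_of_degree_lt (h.degree_div_orthP_lt hq), zero_add]
  rw [map_mod, Lagrange.eq_interpolate (v := id) Function.injective_id.injOn degree_mod_lt,
    Lagrange.interpolate_apply, map_sum]
  refine Finset.sum_congr rfl fun r hr => ?_
  rw [momentFunctional_C_mul, id, eval_mod r hr, mul_comm, gaussWeight]

lemma gaussWeight_pos (h : IsPosDef s) {n : ℕ} {r : ℝ} (hr : r ∈ nodes s n) :
    0 < gaussWeight s n r := by
  set ℓ := Lagrange.basis (nodes s n) id r with hℓ
  have eval_self : ℓ.eval r = 1 := Lagrange.eval_basis_self Function.injective_id.injOn hr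
  have ℓ_ne_zero : ℓ ≠ 0 := fun h0 => by simp [h0] at eval_self
  have natDegree_ℓ : ℓ.natDegree = n - 1 := by
    rw [hℓ, Lagrange.natDegree_basis Function.injective_id.injOn hr, h.card_nodes]
  have degree_sq_lt : (ℓ * ℓ).degree < (2 * n : ℕ) := by
    have : 0 < n := h.card_nodes n ▸ Finset.card_pos.2 ⟨r, hr⟩
    rw [degree_mul, degree_eq_natDegree ℓ_ne_zero, natDegree_ℓ]
    exact_mod_cast (by omega)
  have sum_eq := h.momentFunctional_eq_sum_gaussWeight degree_sq_lt
  rw [Finset.sum_eq_single_of_mem r hr fun t ht htr => ?_, eval_mul, eval_self, mul_one,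
    mul_one] at sum_eq
  · exact sum_eq ▸ h.pos _ ℓ_ne_zero
  · have : ℓ.eval t = 0 :=
      Lagrange.eval_basis_of_ne (v := id) htr.symm ht
    rw [eval_mul, this, mul_zero, mul_zero]

lemma isExactBelow_gaussMeasure (h : IsPosDef s) (n : ℕ) :
    IsExactBelow s (2 * n) (gaussMeasure s n) where
  integrable_eval q := integrable_gaussMeasure s n _
  integral_eval q hq := by
    rw [h.momentFunctional_eq_sum_gaussWeight hq, gaussMeasure, integral_finsetSum_measure]
    · refine Finset.sum_congr rfl fun r hr => ?_
      rw [integral_smul_measure, integral_dirac, ENNReal.toReal_ofReal (h.gaussWeight_pos hr).le,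
        smul_eq_mul]
    · exact fun r _ => (integrable_dirac (by simp)).smul_measure ENNReal.ofReal_ne_top

end IsPosDef

lemma IsExactBelow.isProbabilityMeasure {μ : Measure ℝ} {N : ℕ} (hμ : IsExactBelow s N μ)
    (h : IsPosDef s) (hN : N ≠ 0) : IsProbabilityMeasure μ := by
  have integral_one := hμ.integral_eval 1 (degree_one.trans_lt (by exact_mod_cast hN.bot_lt))
  rw [h.map_one] at integral_one
  exact ⟨by simpa [Measure.real, ENNReal.toReal_eq_one_iff] using integral_one⟩

lemma IsExactBelow.lt_of_mem_nodes {μ : Measure ℝ} {n : ℕ} (hμ : IsExactBelow s (2 * n + 1) μ)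
    (h : IsPosDef s) {p r : ℝ} (hp : ∀ᵐ x ∂μ, p ≤ x) (hr : r ∈ nodes s n) : p < r := by
  by_contra! hrp
  obtain ⟨q, hq⟩ := dvd_iff_isRoot.2 (h.mem_nodes.1 hr)
  have degree_q := h.degree_lt_of_orthP_eq_mul (by rw [natDegree_X_sub_C]; exact one_ne_zero) hq
  have degree_mul_lt (u : ℝ[X]) (hu : u.degree ≤ n) :
      (orthP s n * u).degree < (2 * n + 1 : ℕ) := by
    rw [degree_mul, h.degree_orthP]
    refine (add_le_add_right hu _).trans_lt ?_
    exact_mod_cast (by omega)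
  have integral_eq_zero : ∫ x, (orthP s n * q).eval x ∂μ = 0 := by
    rw [hμ.integral_eval _ (degree_mul_lt q degree_q.le),
      h.momentFunctional_orthP_mul_of_degree_lt degree_q]
  rw [integral_eq_zero_iff_of_nonneg_ae _ (hμ.integrable_eval _)] at integral_eq_zero
  · refine (h.pos _ (h.orthP_ne_zero n)).ne' ?_
    rw [← hμ.integral_eval _ (degree_mul_lt _ (h.degree_orthP n).le)]
    refine integral_eq_zero_of_ae ?_
    filter_upwards [integral_eq_zero] with x hx
    conv_lhs => rw [show orthP s n * orthP s n = (X - C r) * (orthP s n * q) by rw [hq]; ring]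
    rw [eval_mul, hx, Pi.zero_apply, mul_zero]
  · filter_upwards [hp] with x hx
    rw [hq, mul_assoc, eval_mul, eval_mul, eval_sub, eval_X, eval_C]
    exact mul_nonneg (by linarith) (mul_self_nonneg _)

namespace IsPosDef

lemma smallestZero_eq_sInf_nodes (h : IsPosDef s) (n : ℕ) :
    smallestZero s n = sInf (nodes s n : Set ℝ) :=
  congrArg sInf (Set.ext fun _ => h.mem_nodes.symm)

lemma smallestZero_mem_nodes (h : IsPosDef s) {n : ℕ} (hn : n ≠ 0) :
    smallestZero s n ∈ nodes s n := by
  have nodes_nonempty : (nodes s n).Nonempty := by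
    rw [← Finset.card_pos, h.card_nodes]
    exact hn.bot_lt
  exact h.smallestZero_eq_sInf_nodes n ▸ nodes_nonempty.csInf_mem

lemma smallestZero_le (h : IsPosDef s) {n : ℕ} {r : ℝ} (hr : r ∈ nodes s n) :
    smallestZero s n ≤ r :=
  h.smallestZero_eq_sInf_nodes n ▸ csInf_le (nodes s n).finite_toSet.bddBelow hr

lemma ae_smallestZero_le_gaussMeasure (h : IsPosDef s) (n : ℕ) :
    ∀ᵐ x ∂(gaussMeasure s n), smallestZero s n ≤ x :=
  (ae_mem_nodes_gaussMeasure s n).mono fun _ => h.smallestZero_le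

lemma smallestZero_succ_lt (h : IsPosDef s) {n : ℕ} (hn : n ≠ 0) :
    smallestZero s (n + 1) < smallestZero s n :=
  ((h.isExactBelow_gaussMeasure (n + 1)).mono (by omega)).lt_of_mem_nodes h
    (h.ae_smallestZero_le_gaussMeasure (n + 1)) (h.smallestZero_mem_nodes hn)

lemma exists_tendsto_smallestZero (h : IsPosDef s) {p : ℝ} (hp : ∀ n, ∀ r ∈ nodes s n, p < r) :
    ∃ ξ, Tendsto (smallestZero s) atTop (𝓝 ξ) ∧ ∀ n, ∀ r ∈ nodes s n, ξ < r := by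
  have strictAnti : StrictAnti fun n => smallestZero s (n + 1) :=
    strictAnti_nat_of_succ_lt fun n => h.smallestZero_succ_lt n.succ_ne_zero
  have bddBelow : BddBelow (Set.range fun n => smallestZero s (n + 1)) :=
    ⟨p, Set.forall_mem_range.2 fun n => (hp _ _ (h.smallestZero_mem_nodes n.succ_ne_zero)).le⟩
  have tendsto_iInf := tendsto_atTop_ciInf strictAnti.antitone bddBelow
  refine ⟨_, (tendsto_add_atTop_iff_nat 1).1 tendsto_iInf, fun n r hr => ?_⟩
  obtain ⟨k, rfl⟩ : ∃ k, n = k + 1 := Nat.exists_eq_succ_of_ne_zero <| by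
    rintro rfl
    exact Finset.ne_empty_of_mem hr (Finset.card_eq_zero.1 (h.card_nodes 0))
  exact ((strictAnti.antitone.le_of_tendsto tendsto_iInf (k + 1)).trans_lt
    (strictAnti k.lt_succ_self)).trans_le (h.smallestZero_le hr)

end IsPosDef

/-! ### Orthogonal expansion of the resolvent -/

section ResolventExpansion

variable {μ : Measure ℝ}

lemma evalP_ofReal (s : ℕ → ℝ) (x : ℝ) (n : ℕ) :
    evalP s (x : 𝕜) n = ((orthP s n).eval x : ℝ) :=
  aeval_ofReal _ x

lemma evalP_eq_eval (s : ℕ → ℝ) (y : ℝ) (n : ℕ) : evalP s y n = (orthP s n).eval y := by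
  rw [evalP, coe_aeval_eq_eval]

lemma IsPosDef.evalP_mul_one_div_sub (h : IsPosDef s) (n : ℕ) {u v : 𝕜} (huv : u ≠ v) :
    evalP s u n * (1 / (u - v)) =
      evalQ s v n * ∑ k ∈ Finset.range n, evalP s u k * evalP s v k +
        evalP s v n * (1 / (u - v)) -
        evalP s v n * ∑ k ∈ Finset.range n, evalP s u k * evalQ s v k := by
  have sub_ne_zero : u - v ≠ 0 := sub_ne_zero.2 huv
  rw [h.evalP_eq_truncD_mul_sub n u v, truncD, truncB]
  field_simp
  ring

lemma IsExactBelow.integrable_sum_evalP_mul {N : ℕ} (hμ : IsExactBelow s N μ) (n : ℕ)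
    (c : ℕ → 𝕜) :
    Integrable (fun x : ℝ => ∑ k ∈ Finset.range n, evalP s (x : 𝕜) k * c k) μ := by
  simp only [evalP_ofReal]
  exact integrable_finsetSum _ fun k _ => (hμ.integrable_eval _).ofReal.mul_const _

lemma IsExactBelow.integral_sum_evalP_mul {n : ℕ} (hμ : IsExactBelow s n μ) (h : IsPosDef s)
    (c : ℕ → 𝕜) :
    ∫ x : ℝ, ∑ k ∈ Finset.range n, evalP s (x : 𝕜) k * c k ∂μ =
      ∑ k ∈ Finset.range n, if k = 0 then c 0 else 0 := by
  simp only [evalP_ofReal]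
  rw [integral_finsetSum _ fun k _ => (hμ.integrable_eval _).ofReal.mul_const _]
  refine Finset.sum_congr rfl fun k hk => ?_
  have orthogonality := h.momentFunctional_orthP_mul_orthP k 0
  rw [h.orthP_zero, mul_one] at orthogonality
  have degree_lt : (orthP s k).degree < n := by
    rw [h.degree_orthP]
    exact_mod_cast Finset.mem_range.1 hk
  rw [integral_mul_const, integral_ofReal, hμ.integral_eval _ degree_lt, orthogonality]
  split_ifs with hk0 <;> simp [hk0]

lemma IsExactBelow.integral_evalP_mul_one_div_sub {n : ℕ} (hμ : IsExactBelow s n μ)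
    (h : IsPosDef s) {z : 𝕜} (hz : ∀ᵐ x : ℝ ∂μ, (x : 𝕜) ≠ z)
    (hint : Integrable (fun x : ℝ => 1 / ((x : 𝕜) - z)) μ) :
    ∫ x : ℝ, evalP s (x : 𝕜) n * (1 / ((x : 𝕜) - z)) ∂μ =
      evalQ s z n + stieltjes μ z * evalP s z n := by
  have integrable_sum (c : ℕ → 𝕜) := hμ.integrable_sum_evalP_mul n c
  rw [integral_congr_ae (hz.mono fun x hx => h.evalP_mul_one_div_sub n hx),
    integral_sub (by exact ((integrable_sum _).const_mul _).add (hint.const_mul _))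
      ((integrable_sum _).const_mul _),
    integral_add ((integrable_sum _).const_mul _) (hint.const_mul _),
    integral_const_mul, integral_const_mul, integral_const_mul, hμ.integral_sum_evalP_mul h,
    hμ.integral_sum_evalP_mul h, h.evalP_zero, evalQ_zero, ← stieltjes]
  rcases n.eq_zero_or_pos with rfl | hn
  · simp [evalQ_zero, mul_comm]
  · rw [Finset.sum_ite_eq' (Finset.range n) 0, if_pos (Finset.mem_range.2 hn)]
    simp [mul_comm]

end ResolventExpansion

section Bessel

variable {μ ν : Measure ℝ}

namespace IsHamburgerSolution

lemma memLp_evalP (hμ : IsHamburgerSolution s μ) (n : ℕ) :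
    MemLp (fun x : ℝ => evalP s (x : 𝕜) n) 2 μ := by
  simp only [evalP_ofReal]
  rw [memLp_two_iff_integrable_sq_norm (hμ.integrable_eval _).ofReal.aestronglyMeasurable]
  simp only [RCLike.norm_ofReal, sq_abs, ← eval_pow]
  exact hμ.integrable_eval (orthP s n ^ 2)

lemma orthonormal_evalP (hμ : IsHamburgerSolution s μ) (h : IsPosDef s) :
    Orthonormal 𝕜 fun n => (hμ.memLp_evalP (𝕜 := 𝕜) n).toLp := by
  rw [orthonormal_iff_ite]
  intro m n
  rw [L2.inner_def]
  calc ∫ x, inner 𝕜 ((hμ.memLp_evalP m).toLp _ x) ((hμ.memLp_evalP n).toLp _ x) ∂μ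
      = ∫ x, (((orthP s m * orthP s n).eval x : ℝ) : 𝕜) ∂μ := by
        refine integral_congr_ae ?_
        filter_upwards [(hμ.memLp_evalP (𝕜 := 𝕜) m).coeFn_toLp,
          (hμ.memLp_evalP (𝕜 := 𝕜) n).coeFn_toLp] with x hm hn
        rw [hm, hn, evalP_ofReal, evalP_ofReal, eval_mul, RCLike.inner_apply, RCLike.conj_ofReal,
          RCLike.ofReal_mul, mul_comm]
    _ = if m = n then 1 else 0 := by
        rw [integral_ofReal, hμ.integral_eval, h.momentFunctional_orthP_mul_orthP]
        split_ifs <;> simp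

lemma summable_norm_evalQ_add_sq (hμ : IsHamburgerSolution s μ) (h : IsPosDef s) {z : 𝕜} {δ : ℝ}
    (hδ : 0 < δ) (hz : ∀ᵐ x : ℝ ∂μ, δ ≤ ‖(x : 𝕜) - z‖) :
    Summable fun n => ‖evalQ s z n + stieltjes μ z * evalP s z n‖ ^ 2 := by
  have := hμ.isProbabilityMeasure
  have integrable_resolvent := integrable_one_div_sub_of_le_norm hδ hz
  have memLp_resolvent : MemLp (fun x : ℝ => 1 / ((x : 𝕜) - z)) 2 μ := by
    refine MemLp.of_bound integrable_resolvent.aestronglyMeasurable (1 / δ) ?_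
    filter_upwards [hz] with x hx
    rw [norm_div, norm_one]
    exact one_div_le_one_div_of_le hδ hx
  have ne_z : ∀ᵐ x : ℝ ∂μ, (x : 𝕜) ≠ z := hz.mono fun x hx =>
    sub_ne_zero.1 (norm_pos_iff.1 (hδ.trans_le hx))
  refine ((hμ.orthonormal_evalP h).inner_products_summable memLp_resolvent.toLp).congr fun n => ?_
  rw [← (hμ.isExactBelow n).integral_evalP_mul_one_div_sub h ne_z integrable_resolvent,
    L2.inner_def]
  congr 2
  refine integral_congr_ae ?_
  filter_upwards [(hμ.memLp_evalP (𝕜 := 𝕜) n).coeFn_toLp, memLp_resolvent.coeFn_toLp]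
    with x hn hx
  rw [hn, hx, evalP_ofReal, RCLike.inner_apply, RCLike.conj_ofReal, mul_comm]

end IsHamburgerSolution

lemma IsPosDef.isLimitCircle_of_ne (h : IsPosDef s) (hμ : IsHamburgerSolution s μ)
    (hν : IsHamburgerSolution s ν) (hne : μ ≠ ν) : IsLimitCircle ℂ s := by
  have := hμ.isProbabilityMeasure
  have := hν.isProbabilityMeasure
  obtain ⟨z, hz, stieltjes_ne⟩ : ∃ z : ℂ, z.im ≠ 0 ∧ stieltjes μ z ≠ stieltjes ν z := by
    by_contra! heq
    exact hne (ext_of_stieltjes_eq heq)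
  set w := stieltjes μ z - stieltjes ν z
  have w_ne_zero : w ≠ 0 := sub_ne_zero.2 stieltjes_ne
  have summable_sq {f g : ℕ → ℂ} (a b : ℂ) (hf : Summable fun n => ‖f n‖ ^ 2)
      (hg : Summable fun n => ‖g n‖ ^ 2) : Summable fun n => ‖a * f n + b * g n‖ ^ 2 := by
    refine Summable.of_nonneg_of_le (fun n => sq_nonneg _) (fun n => ?_)
      (summable_add_sq (f := fun n => ‖a * f n‖) (g := fun n => ‖b * g n‖) ?_ ?_)
    · gcongr
      exact norm_add_le _ _
    · simpa only [norm_mul, mul_pow] using hf.mul_left _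
    · simpa only [norm_mul, mul_pow] using hg.mul_left _
  have im_le := abs_im_le_norm_ofReal_sub z
  have summable_μ := hμ.summable_norm_evalQ_add_sq h (abs_pos.2 hz) (.of_forall im_le)
  have summable_ν := hν.summable_norm_evalQ_add_sq h (abs_pos.2 hz) (.of_forall im_le)
  refine h.isLimitCircle_of_summable (y := z) ?_ ?_
  · refine (summable_sq (1 / w) (-(1 / w)) summable_μ summable_ν).congr fun n => ?_
    congr 2
    field_simp
    simp only [w]
    ring
  · refine (summable_sq (-(stieltjes ν z / w)) (stieltjes μ z / w) summable_μ summable_ν).congr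
      fun n => ?_
    congr 2
    field_simp
    simp only [w]
    ring

end Bessel

/-! ### Bounds for the Stieltjes transform to the left of the support -/

section KernelPoly

/-- The reproducing kernel `∑ P_k(p) P_k`, `k < n`, of the polynomials of degree less than `n`, as a
polynomial in one of its two variables. -/
def kernelPoly (s : ℕ → ℝ) (n : ℕ) (p : ℝ) : ℝ[X] :=
  ∑ k ∈ Finset.range n, C ((orthP s k).eval p) * orthP s k

lemma sub_mul_eval_kernelPoly (s : ℕ → ℝ) (n : ℕ) (y p : ℝ) :
    (y - p) * (kernelPoly s n p).eval y = truncD s n y p := by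
  simp only [kernelPoly, truncD, eval_finsetSum, eval_mul, eval_C, evalP_eq_eval, mul_comm]

namespace IsPosDef

lemma degree_kernelPoly_lt (h : IsPosDef s) (n : ℕ) (p : ℝ) : (kernelPoly s n p).degree < n := by
  rw [← mem_degreeLT]
  refine Submodule.sum_mem _ fun k hk => ?_
  rw [← smul_eq_C_mul]
  refine Submodule.smul_mem _ _ (mem_degreeLT.2 ?_)
  rw [h.degree_orthP]
  exact_mod_cast Finset.mem_range.1 hk

lemma momentFunctional_kernelPoly_mul (h : IsPosDef s) {n : ℕ} {q : ℝ[X]} (hq : q.degree < n)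
    (p : ℝ) : momentFunctional s (kernelPoly s n p * q) = q.eval p := by
  conv_rhs => rw [← h.sum_momentFunctional_mul_orthP hq]
  simp only [kernelPoly, Finset.sum_mul, map_sum, eval_finsetSum, eval_mul, eval_C, mul_assoc,
    momentFunctional_C_mul]
  exact Finset.sum_congr rfl fun k _ => by rw [mul_comm, mul_comm q]

end IsPosDef

end KernelPoly

namespace IsHamburgerSolution

variable {μ : Measure ℝ} {p y : ℝ}

lemma integrable_eval_mul_one_div_sub (hμ : IsHamburgerSolution s μ) (hp : ∀ᵐ x ∂μ, p ≤ x)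
    (hy : y < p) (q : ℝ[X]) : Integrable (fun x => q.eval x * (1 / (x - y))) μ := by
  refine (hμ.integrable_eval q).mul_bdd (c := 1 / (p - y)) ?_ ?_
  · exact (by fun_prop : Measurable fun x : ℝ => 1 / (x - y)).aestronglyMeasurable
  · filter_upwards [hp] with x hx
    rw [Real.norm_of_nonneg (one_div_nonneg.2 (by linarith))]
    exact one_div_le_one_div_of_le (sub_pos.2 hy) (by linarith)

lemma integral_orthP_mul_one_div_sub (hμ : IsHamburgerSolution s μ) (h : IsPosDef s)
    (hp : ∀ᵐ x ∂μ, p ≤ x) (hy : y < p) (n : ℕ) :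
    ∫ x, (orthP s n).eval x * (1 / (x - y)) ∂μ = evalQ s y n + stieltjes μ y * evalP s y n := by
  have := hμ.isProbabilityMeasure
  exact (hμ.isExactBelow n).integral_evalP_mul_one_div_sub (𝕜 := ℝ) h
    (hp.mono fun x hx => (hy.trans_le hx).ne') (integrable_one_div_sub_of_lt hy hp)

lemma integral_mul_mul_one_div_sub (hμ : IsHamburgerSolution s μ) (hp : ∀ᵐ x ∂μ, p ≤ x)
    (hy : y < p) (f q : ℝ[X]) :
    ∫ x, (f * q).eval x * (1 / (x - y)) ∂μ =
      momentFunctional s (f * (q /ₘ (X - C y))) +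
        q.eval y * ∫ x, f.eval x * (1 / (x - y)) ∂μ := by
  rw [← hμ.integral_eval, ← integral_const_mul, ← integral_add (hμ.integrable_eval _)
    ((hμ.integrable_eval_mul_one_div_sub hp hy f).const_mul _)]
  refine integral_congr_ae ?_
  filter_upwards [hp] with x hx
  have sub_ne_zero : x - y ≠ 0 := by linarith
  have division := congrArg (eval x) (modByMonic_add_div q (X - C y))
  rw [modByMonic_X_sub_C_eq_C_eval, eval_add, eval_C, eval_mul, eval_sub, eval_X, eval_C]
    at division
  rw [eval_mul, eval_mul, ← division]
  field_simp
  ring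

/-- The `n`-point Gauss quadrature has Stieltjes transform `-Q_n / P_n`, so this says that it bounds
the Stieltjes transform of every solution from below. -/
lemma evalP_mul_evalQ_add_nonneg (hμ : IsHamburgerSolution s μ) (h : IsPosDef s)
    (hp : ∀ᵐ x ∂μ, p ≤ x) (hy : y < p) (n : ℕ) :
    0 ≤ evalP s y n * (evalQ s y n + stieltjes μ y * evalP s y n) := by
  have degree_lt : (orthP s n /ₘ (X - C y)).degree < n := by
    rw [← h.degree_orthP n]
    exact degree_divByMonic_lt _ _ (h.orthP_ne_zero n) (by rw [degree_X_sub_C]; exact one_pos)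
  have integral_eq := hμ.integral_mul_mul_one_div_sub hp hy (orthP s n) (orthP s n)
  rw [h.momentFunctional_orthP_mul_of_degree_lt degree_lt, zero_add,
    hμ.integral_orthP_mul_one_div_sub h hp hy, ← evalP_eq_eval] at integral_eq
  refine integral_eq ▸ integral_nonneg_of_ae ?_
  filter_upwards [hp] with x hx
  rw [eval_mul]
  exact mul_nonneg (mul_self_nonneg _) (one_div_nonneg.2 (by linarith))

lemma sub_mul_integral_kernelPoly_mul_one_div_sub (hμ : IsHamburgerSolution s μ)
    (h : IsPosDef s) (hp : ∀ᵐ x ∂μ, p ≤ x) (hy : y < p) (n : ℕ) :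
    1 + (y - p) * ∫ x, (kernelPoly s n p).eval x * (1 / (x - y)) ∂μ =
      truncC s n y p + stieltjes μ y * truncD s n y p := by
  have integral_eq : ∫ x, (kernelPoly s n p).eval x * (1 / (x - y)) ∂μ =
      ∑ k ∈ Finset.range n, evalP s p k * (evalQ s y k + stieltjes μ y * evalP s y k) := by
    simp only [kernelPoly, eval_finsetSum, eval_mul, eval_C, Finset.sum_mul, mul_assoc]
    rw [integral_finsetSum _ fun k _ =>
      (hμ.integrable_eval_mul_one_div_sub hp hy _).const_mul _]
    refine Finset.sum_congr rfl fun k _ => ?_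
    rw [integral_const_mul, hμ.integral_orthP_mul_one_div_sub h hp hy, ← evalP_eq_eval]
  rw [integral_eq, truncC, truncD, add_assoc, mul_left_comm (stieltjes μ y), ← mul_add,
    Finset.mul_sum (a := stieltjes μ y), ← Finset.sum_add_distrib]
  congr 2
  exact Finset.sum_congr rfl fun k _ => by ring

/-- The quadrature with nodes at `p` and at the zeros of `kernelPoly s n p` has Stieltjes transform
`-C_n / D_n`, so this says that it bounds the Stieltjes transform of every solution on `[p, ∞)` from
above. -/
lemma truncD_mul_truncC_add_nonpos (hμ : IsHamburgerSolution s μ) (h : IsPosDef s)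
    (hp : ∀ᵐ x ∂μ, p ≤ x) (hy : y < p) (n : ℕ) :
    truncD s n y p * (truncC s n y p + stieltjes μ y * truncD s n y p) ≤ 0 := by
  set K := kernelPoly s n p
  set q := (X - C p) * K
  have eval_div : (q /ₘ (X - C y)).eval p = K.eval y := by
    have division := congrArg (eval p) (modByMonic_add_div q (X - C y))
    rw [modByMonic_X_sub_C_eq_C_eval, eval_add, eval_C, eval_mul, eval_sub, eval_X, eval_C,
      eval_mul, eval_sub, eval_X, eval_C, eval_mul, eval_sub, eval_X, eval_C] at division
    exact mul_left_cancel₀ (sub_pos.2 hy).ne' (by linear_combination division)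
  have degree_lt : (q /ₘ (X - C y)).degree < n := by
    have degree_le : q.degree ≤ n := by
      rw [degree_mul, degree_X_sub_C, add_comm]
      exact Nat.WithBot.add_one_le_of_lt (h.degree_kernelPoly_lt n p)
    rcases eq_or_ne q 0 with hq | hq
    · rw [hq, zero_divByMonic, degree_zero]
      exact WithBot.bot_lt_coe n
    · exact (degree_divByMonic_lt _ _ hq (by rw [degree_X_sub_C]; exact one_pos)).trans_le degree_le
  have integral_eq := hμ.integral_mul_mul_one_div_sub hp hy K q
  rw [h.momentFunctional_kernelPoly_mul degree_lt, eval_div] at integral_eq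
  have integral_nonneg : 0 ≤ ∫ x, (K * q).eval x * (1 / (x - y)) ∂μ := by
    refine integral_nonneg_of_ae ?_
    filter_upwards [hp] with x hx
    have : (K * q).eval x = (x - p) * (K.eval x * K.eval x) := by
      simp only [q, eval_mul, eval_sub, eval_X, eval_C]
      ring
    rw [this]
    exact mul_nonneg (mul_nonneg (sub_nonneg.2 hx) (mul_self_nonneg _))
      (one_div_nonneg.2 (by linarith))
  rw [← hμ.sub_mul_integral_kernelPoly_mul_one_div_sub h hp hy n, ← sub_mul_eval_kernelPoly,
    mul_assoc]
  refine mul_nonpos_of_nonpos_of_nonneg (sub_nonpos.2 hy.le) ?_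
  rw [integral_eq] at integral_nonneg
  simp only [q, eval_mul, eval_sub, eval_X, eval_C] at integral_nonneg
  linarith

end IsHamburgerSolution

/-! ### The ratios of the two kinds of polynomials -/

section Ratio

namespace IsPosDef

section Limit

variable {u v b d t : 𝕜}

lemma tendsto_evalP_div_evalQ (h : IsPosDef s)
    (hB : Tendsto (fun n => truncB s n u v) atTop (𝓝 b))
    (hD : Tendsto (fun n => truncD s n u v) atTop (𝓝 d)) (hv : ∀ᶠ n in atTop, evalQ s v n ≠ 0)
    (ht : Tendsto (fun n => evalP s v n / evalQ s v n) atTop (𝓝 t)) :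
    Tendsto (fun n => evalP s u n / evalQ s v n) atTop (𝓝 (d - b * t)) := by
  refine (hD.sub (hB.mul ht)).congr' (hv.mono fun n hn => ?_)
  beta_reduce
  rw [h.evalP_eq_truncD_mul_sub n u v]
  field_simp

lemma tendsto_evalQ_div_evalQ (h : IsPosDef s)
    (hA : Tendsto (fun n => truncA s n u v) atTop (𝓝 b))
    (hC : Tendsto (fun n => truncC s n u v) atTop (𝓝 d)) (hv : ∀ᶠ n in atTop, evalQ s v n ≠ 0)
    (ht : Tendsto (fun n => evalP s v n / evalQ s v n) atTop (𝓝 t)) :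
    Tendsto (fun n => evalQ s u n / evalQ s v n) atTop (𝓝 (d - b * t)) := by
  refine (hC.sub (hA.mul ht)).congr' (hv.mono fun n hn => ?_)
  beta_reduce
  rw [h.evalQ_eq_truncC_mul_sub n u v]
  field_simp

end Limit

variable {p y : ℝ}

lemma neg_one_pow_mul_evalP_pos (h : IsPosDef s) (hp : ∀ n, ∀ r ∈ nodes s n, p < r) (n : ℕ) :
    0 < (-1) ^ n * evalP s p n := by
  rw [evalP_eq_eval]
  exact h.neg_one_pow_mul_eval_orthP_pos (hp n)

lemma evalP_ne_zero (h : IsPosDef s) (hp : ∀ n, ∀ r ∈ nodes s n, p < r) (n : ℕ) :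
    evalP s p n ≠ 0 :=
  right_ne_zero_of_mul (h.neg_one_pow_mul_evalP_pos hp n).ne'

lemma truncD_le_sub (h : IsPosDef s) (hp : ∀ n, ∀ r ∈ nodes s n, p < r) (hy : y ≤ p) {n : ℕ}
    (hn : n ≠ 0) : truncD s n y p ≤ y - p := by
  have evalP_mul_pos (k : ℕ) : 0 < evalP s y k * evalP s p k := by
    have := mul_pos (h.neg_one_pow_mul_evalP_pos (fun n r hr => hy.trans_lt (hp n r hr)) k)
      (h.neg_one_pow_mul_evalP_pos hp k)
    rwa [mul_mul_mul_comm, ← mul_pow, neg_one_mul, neg_neg, one_pow, one_mul] at this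
  have one_le_sum : 1 ≤ ∑ k ∈ Finset.range n, evalP s y k * evalP s p k := by
    have := Finset.single_le_sum (fun k _ => (evalP_mul_pos k).le)
      (Finset.mem_range.2 (Nat.pos_of_ne_zero hn))
    rwa [h.evalP_zero, h.evalP_zero, one_mul] at this
  exact (mul_le_mul_of_nonpos_left one_le_sum (sub_nonpos.2 hy)).trans_eq (mul_one _)

lemma strictMono_neg_evalQ_div_evalP (h : IsPosDef s) (hp : ∀ n, ∀ r ∈ nodes s n, p < r) :
    StrictMono fun n => -evalQ s p n / evalP s p n := by
  refine strictMono_nat_of_lt_succ fun n => ?_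
  have mul_neg : evalP s p n * evalP s p (n + 1) < 0 := by
    have := mul_pos (h.neg_one_pow_mul_evalP_pos hp n) (h.neg_one_pow_mul_evalP_pos hp (n + 1))
    rw [mul_mul_mul_comm, ← pow_add, Odd.neg_one_pow ⟨n, by ring⟩] at this
    linarith
  have wronskian_pos : 0 < evalQ s p (n + 1) * evalP s p n - evalQ s p n * evalP s p (n + 1) := by
    have wronskian := h.jacobiWronskian_evalQ_evalP_self n p
    exact pos_of_mul_pos_right (one_pos.trans_eq wronskian.symm) (h.jacobiB_pos n).le
  have sub_eq : -evalQ s p (n + 1) / evalP s p (n + 1) - -evalQ s p n / evalP s p n =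
      (evalQ s p (n + 1) * evalP s p n - evalQ s p n * evalP s p (n + 1)) /
        -(evalP s p n * evalP s p (n + 1)) := by
    have := h.evalP_ne_zero hp n
    have := h.evalP_ne_zero hp (n + 1)
    field_simp
    ring
  exact sub_pos.1 (sub_eq ▸ div_pos wronskian_pos (neg_pos.2 mul_neg))

lemma neg_evalQ_div_evalP_pos (h : IsPosDef s) (hp : ∀ n, ∀ r ∈ nodes s n, p < r) {n : ℕ}
    (hn : n ≠ 0) : 0 < -evalQ s p n / evalP s p n := by
  simpa [evalQ_zero] using h.strictMono_neg_evalQ_div_evalP hp (Nat.pos_of_ne_zero hn)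

lemma eventually_evalQ_ne_zero (h : IsPosDef s) (hp : ∀ n, ∀ r ∈ nodes s n, p < r) :
    ∀ᶠ n in atTop, evalQ s p n ≠ 0 := by
  filter_upwards [eventually_ne_atTop 0] with n hn h0
  simpa [h0] using h.neg_evalQ_div_evalP_pos hp hn

lemma tendsto_neg_evalQ_div_evalP_atTop (h : IsPosDef s) (hL : IsLimitCircle ℝ s) {ξ : ℝ}
    (hξ : Tendsto (smallestZero s) atTop (𝓝 ξ)) (hp : ∀ n, ∀ r ∈ nodes s n, ξ < r) :
    Tendsto (fun n => -evalQ s ξ n / evalP s ξ n) atTop atTop := by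
  have monotone_ratio := (h.strictMono_neg_evalQ_div_evalP hp).monotone
  refine (tendsto_atTop_of_monotone monotone_ratio).resolve_right ?_
  rintro ⟨l, hl⟩
  have truncD_mul_ratio : ∀ᶠ n in atTop,
      truncD s n (smallestZero s n) ξ * (-evalQ s ξ n / evalP s ξ n) =
        -truncB s n (smallestZero s n) ξ := by
    filter_upwards [eventually_ne_atTop 0] with n hn
    have root := h.mem_nodes.1 (h.smallestZero_mem_nodes hn)
    rw [← evalP_eq_eval, h.evalP_eq_truncD_mul_sub n _ ξ] at root
    have := h.evalP_ne_zero hp n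
    field_simp
    linear_combination -root
  have tendsto_zero := (hL.tendsto_truncD_of_tendsto hξ).mul hl
  have tendsto_one := (hL.tendsto_truncB_of_tendsto hξ).neg
  rw [zero_mul] at tendsto_zero
  have := tendsto_nhds_unique (tendsto_zero.congr' truncD_mul_ratio) tendsto_one
  norm_num at this

end IsPosDef

lemma IsHamburgerSolution.lt_of_mem_nodes {μ : Measure ℝ} {p : ℝ} (hμ : IsHamburgerSolution s μ)
    (h : IsPosDef s) (hp : ∀ᵐ x ∂μ, p ≤ x) (n : ℕ) (r : ℝ) (hr : r ∈ nodes s n) : p < r :=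
  have := hμ.isProbabilityMeasure
  (hμ.isExactBelow _).lt_of_mem_nodes h hp hr

lemma IsHamburgerSolution.add_stieltjes_mul_eq_zero {μ : Measure ℝ} {p y c d : ℝ}
    (hμ : IsHamburgerSolution s μ) (h : IsPosDef s) (hL : IsLimitCircle ℝ s)
    (hp : ∀ᵐ x ∂μ, p ≤ x) (hy : y < p)
    (hr : Tendsto (fun n => -evalQ s p n / evalP s p n) atTop atTop)
    (hC : Tendsto (fun n => truncC s n y p) atTop (𝓝 c))
    (hD : Tendsto (fun n => truncD s n y p) atTop (𝓝 d)) : c + stieltjes μ y * d = 0 := by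
  have lt_nodes := hμ.lt_of_mem_nodes h hp
  have evalQ_ne_zero := h.eventually_evalQ_ne_zero lt_nodes
  have tendsto_evalP_div : Tendsto (fun n => evalP s p n / evalQ s p n) atTop (𝓝 0) := by
    have := hr.inv_tendsto_atTop.neg
    simpa [div_neg, neg_div] using this
  have tendsto_P := h.tendsto_evalP_div_evalQ (hL.tendsto_truncB y p) hD evalQ_ne_zero
    tendsto_evalP_div
  have tendsto_Q := h.tendsto_evalQ_div_evalQ (hL.tendsto_truncA y p) hC evalQ_ne_zero
    tendsto_evalP_div
  rw [mul_zero, sub_zero] at tendsto_P tendsto_Q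
  have lower : 0 ≤ d * (c + stieltjes μ y * d) := by
    refine ge_of_tendsto' (tendsto_P.mul (tendsto_Q.add (tendsto_P.const_mul _))) fun n => ?_
    refine (div_nonneg (hμ.evalP_mul_evalQ_add_nonneg h hp hy n)
      (mul_self_nonneg (evalQ s p n))).trans_eq ?_
    ring
  have upper : d * (c + stieltjes μ y * d) ≤ 0 :=
    le_of_tendsto' (hD.mul (hC.add (hD.const_mul _))) (hμ.truncD_mul_truncC_add_nonpos h hp hy)
  have d_neg : d < 0 := by
    refine (le_of_tendsto hD ?_).trans_lt (sub_neg.2 hy)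
    filter_upwards [eventually_ne_atTop 0] with n hn using h.truncD_le_sub lt_nodes hy.le hn
  exact (mul_eq_zero.1 (upper.antisymm lower)).resolve_left d_neg.ne

lemma IsPosDef.eq_of_tendsto_neg_evalQ_div_evalP_atTop {μ ν : Measure ℝ} {p : ℝ} (h : IsPosDef s)
    (hL : IsLimitCircle ℝ s) (hμ : IsHamburgerSolution s μ) (hν : IsHamburgerSolution s ν)
    (hμp : ∀ᵐ x ∂μ, p ≤ x) (hνp : ∀ᵐ x ∂ν, p ≤ x)
    (hr : Tendsto (fun n => -evalQ s p n / evalP s p n) atTop atTop) : μ = ν := by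
  have := hμ.isProbabilityMeasure
  have := hν.isProbabilityMeasure
  refine ext_of_stieltjes_eq_of_lt hμp hνp fun y hy => ?_
  have tendsto_C := hL.tendsto_truncC y p
  have tendsto_D := hL.tendsto_truncD y p
  have eq_μ := hμ.add_stieltjes_mul_eq_zero h hL hμp hy hr tendsto_C tendsto_D
  have eq_ν := hν.add_stieltjes_mul_eq_zero h hL hνp hy hr tendsto_C tendsto_D
  refine mul_right_cancel₀ (fun h0 => ?_) (add_left_cancel (eq_μ.trans eq_ν.symm))
  have := le_of_tendsto tendsto_D ((eventually_ne_atTop 0).mono fun n hn =>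
    h.truncD_le_sub (hμ.lt_of_mem_nodes h hμp) hy.le hn)
  linarith

lemma IsPosDef.exists_tendsto_evalP_div_evalQ {μ ν : Measure ℝ} {p : ℝ} (h : IsPosDef s)
    (hL : IsLimitCircle ℝ s) (hμ : IsHamburgerSolution s μ) (hν : IsHamburgerSolution s ν)
    (hμp : ∀ᵐ x ∂μ, p ≤ x) (hνp : ∀ᵐ x ∂ν, p ≤ x) (hne : μ ≠ ν) :
    ∃ α < 0, Tendsto (fun n => evalP s p n / evalQ s p n) atTop (𝓝 α) := by
  have lt_nodes := hμ.lt_of_mem_nodes h hμp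
  have monotone_ratio := (h.strictMono_neg_evalQ_div_evalP lt_nodes).monotone
  rcases tendsto_atTop_of_monotone monotone_ratio with htop | ⟨l, hl⟩
  · exact absurd (h.eq_of_tendsto_neg_evalQ_div_evalP_atTop hL hμ hν hμp hνp htop) hne
  · have l_pos : 0 < l := (h.neg_evalQ_div_evalP_pos lt_nodes one_ne_zero).trans_le
      (monotone_ratio.ge_of_tendsto hl 1)
    refine ⟨-l⁻¹, neg_lt_zero.2 (inv_pos.2 l_pos), (hl.inv₀ l_pos.ne').neg.congr fun n => ?_⟩
    rw [inv_div, div_neg, neg_neg]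

end Ratio

/-! ### Weak limits -/

section WeakLimit

variable {Ω : Type*} [TopologicalSpace Ω] [MeasurableSpace Ω] [OpensMeasurableSpace Ω]
  [HasOuterApproxClosed Ω]

lemma ae_mem_of_tendsto {m : ℕ → ProbabilityMeasure Ω} {F : ProbabilityMeasure Ω} {S : Set Ω}
    (hm : Tendsto m atTop (𝓝 F)) (hS : IsClosed S) (hmS : ∀ n, ∀ᵐ x ∂(m n : Measure Ω), x ∈ S) :
    ∀ᵐ x ∂(F : Measure Ω), x ∈ S := by
  have le_liminf := ProbabilityMeasure.le_liminf_measure_open_of_tendsto hm hS.isOpen_compl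
  simp only [fun n => show (m n : Measure Ω) Sᶜ = 0 from hmS n, liminf_const,
    nonpos_iff_eq_zero] at le_liminf
  exact le_liminf

lemma integrable_and_integral_le_of_tendsto {m : ℕ → ProbabilityMeasure Ω}
    {F : ProbabilityMeasure Ω} {f : Ω → ℝ} {c : ℝ} (hm : Tendsto m atTop (𝓝 F))
    (hf : Continuous f) (hf0 : 0 ≤ f)
    (hc : ∀ᶠ n in atTop, Integrable f (m n : Measure Ω) ∧ ∫ x, f x ∂(m n : Measure Ω) ≤ c) :
    Integrable f (F : Measure Ω) ∧ ∫ x, f x ∂(F : Measure Ω) ≤ c := by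
  have fatou : ∫⁻ x, ENNReal.ofReal (f x) ∂(F : Measure Ω) ≤ ENNReal.ofReal c := by
    refine (lintegral_le_liminf_lintegral_of_forall_isOpen_measure_le_liminf_measure hf hf0
      fun U hU => ProbabilityMeasure.le_liminf_measure_open_of_tendsto hm hU).trans
      (liminf_le_of_frequently_le' (hc.mono fun n hn => ?_).frequently)
    rw [← ofReal_integral_eq_lintegral_ofReal hn.1 (.of_forall hf0)]
    exact ENNReal.ofReal_le_ofReal hn.2
  have integrable_f : Integrable f (F : Measure Ω) :=
    (lintegral_ofReal_ne_top_iff_integrable hf.aestronglyMeasurable (.of_forall hf0)).1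
      (ne_top_of_le_ne_top ENNReal.ofReal_ne_top fatou)
  refine ⟨integrable_f, ?_⟩
  obtain ⟨n, hn⟩ := hc.exists
  rw [← ofReal_integral_eq_lintegral_ofReal integrable_f (.of_forall hf0)] at fatou
  exact (ENNReal.ofReal_le_ofReal_iff ((integral_nonneg hf0).trans hn.2)).1 fatou

end WeakLimit

section MomentLimit

variable {m : ℕ → ProbabilityMeasure ℝ} {F : ProbabilityMeasure ℝ}

lemma integrable_and_integral_eval_sq_le_of_tendsto (hm : Tendsto m atTop (𝓝 F))
    (hs : ∀ N, ∀ᶠ n in atTop, IsExactBelow s N (m n)) (q : ℝ[X]) :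
    Integrable (fun x => (q ^ 2).eval x) (F : Measure ℝ) ∧
      ∫ x, (q ^ 2).eval x ∂(F : Measure ℝ) ≤ momentFunctional s (q ^ 2) := by
  refine integrable_and_integral_le_of_tendsto hm (q ^ 2).continuous
    (fun x => (eval_pow (R := ℝ) 2).symm ▸ sq_nonneg _)
    ((hs ((q ^ 2).natDegree + 1)).mono fun n hn => ⟨hn.integrable_eval _, ?_⟩)
  refine (hn.integral_eval _ (degree_le_natDegree.trans_lt ?_)).le
  exact_mod_cast Nat.lt_succ_self _

lemma integrable_eval_of_tendsto (hm : Tendsto m atTop (𝓝 F))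
    (hs : ∀ N, ∀ᶠ n in atTop, IsExactBelow s N (m n)) (q : ℝ[X]) :
    Integrable (fun x => q.eval x) (F : Measure ℝ) := by
  refine ((integrable_and_integral_eval_sq_le_of_tendsto hm hs q).1.add
    (integrable_const (1 : ℝ))).mono' q.continuous.aestronglyMeasurable (.of_forall fun x => ?_)
  rw [Pi.add_apply, eval_pow, Real.norm_eq_abs, abs_le]
  constructor <;> nlinarith [sq_nonneg (q.eval x - 1), sq_nonneg (q.eval x + 1)]

-- Cauchy-Schwarz for the functional `q ↦ L q - ∫ q dF`, nonnegative on squares and zero at `1`.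
lemma integral_eval_of_tendsto (hm : Tendsto m atTop (𝓝 F))
    (hs : ∀ N, ∀ᶠ n in atTop, IsExactBelow s N (m n)) (q : ℝ[X]) :
    ∫ x, q.eval x ∂(F : Measure ℝ) = momentFunctional s q := by
  have map_one : momentFunctional s 1 = 1 := by
    obtain ⟨n, hn⟩ := (hs 1).exists
    simpa using (hn.integral_eval 1 (by rw [degree_one]; exact_mod_cast one_pos)).symm
  have discrim_nonpos := discrim_le_zero
    (a := momentFunctional s (q ^ 2) - ∫ x, (q ^ 2).eval x ∂(F : Measure ℝ))
    (b := 2 * (momentFunctional s q - ∫ x, q.eval x ∂(F : Measure ℝ))) (c := 0) fun t => by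
      have sq_le := (integrable_and_integral_eval_sq_le_of_tendsto hm hs (C t * q + 1)).2
      have sq_eq : (C t * q + 1) ^ 2 = C (t * t) * q ^ 2 + C (2 * t) * q + 1 := by
        simp only [C_mul, C_ofNat]
        ring
      have integrable_sq := (integrable_and_integral_eval_sq_le_of_tendsto hm hs q).1.const_mul
        (t * t)
      have integrable_q := (integrable_eval_of_tendsto hm hs q).const_mul (2 * t)
      simp only [sq_eq, map_add, momentFunctional_C_mul, map_one, eval_add, eval_C_mul,
        eval_one, integral_add (integrable_sq.fun_add integrable_q) (integrable_const 1),
        integral_add integrable_sq integrable_q, integral_const_mul, integral_const,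
        probReal_univ, one_smul] at sq_le
      linarith
  rw [discrim] at discrim_nonpos
  nlinarith

lemma isHamburgerSolution_of_tendsto (hm : Tendsto m atTop (𝓝 F))
    (hs : ∀ N, ∀ᶠ n in atTop, IsExactBelow s N (m n)) : IsHamburgerSolution s F :=
  ⟨inferInstance, fun n => by simpa using integrable_eval_of_tendsto hm hs (X ^ n), fun n => by
    simpa [momentFunctional_X_pow] using integral_eval_of_tendsto hm hs (X ^ n)⟩

end MomentLimit

lemma exists_subseq_tendsto_of_integral_norm_le {E : Type*} [NormedAddCommGroup E]
    [ProperSpace E] [MeasurableSpace E] [BorelSpace E] (m : ℕ → ProbabilityMeasure E) {c : ℝ}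
    (hint : ∀ n, Integrable (fun x => x) (m n : Measure E))
    (hc : ∀ n, ∫ x, ‖x‖ ∂(m n : Measure E) ≤ c) :
    ∃ (F : ProbabilityMeasure E) (φ : ℕ → ℕ), StrictMono φ ∧ Tendsto (m ∘ φ) atTop (𝓝 F) := by
  have tendsto_zero : Tendsto (fun r : ℝ => ENNReal.ofReal (c / r)) atTop (𝓝 0) := by
    simpa using ENNReal.tendsto_ofReal (tendsto_const_nhds.div_atTop tendsto_id)
  have markov (n : ℕ) {r : ℝ} (hr : 0 < r) :
      (m n : Measure E) {x | r < ‖x‖} ≤ ENNReal.ofReal (c / r) := by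
    refine (measure_mono (t := {x | r ≤ ‖x‖}) fun x (hx : r < ‖x‖) => hx.le).trans ?_
    rw [← ofReal_measureReal]
    refine ENNReal.ofReal_le_ofReal ((le_div_iff₀' hr).2 ?_)
    exact (mul_meas_ge_le_integral_of_nonneg (.of_forall fun x => norm_nonneg x) (hint n).norm
      r).trans (hc n)
  have tight : IsTightMeasureSet {((μ : ProbabilityMeasure E) : Measure E) | μ ∈ Set.range m} := by
    refine isTightMeasureSet_of_tendsto_measure_norm_gt <|
      tendsto_of_tendsto_of_tendsto_of_le_of_le' tendsto_const_nhds tendsto_zero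
        (.of_forall fun _ => zero_le) ((eventually_gt_atTop 0).mono fun r hr => iSup₂_le ?_)
    rintro _ ⟨_, ⟨n, rfl⟩, rfl⟩
    exact markov n hr
  obtain ⟨F, -, φ, hφ, hF⟩ := (isCompact_closure_of_isTightMeasureSet tight).isSeqCompact
    fun n => subset_closure ⟨n, rfl⟩
  exact ⟨F, φ, hφ, hF⟩

lemma tendsto_stieltjes_of_tendsto {m : ℕ → ProbabilityMeasure ℝ} {F : ProbabilityMeasure ℝ}
    (hm : Tendsto m atTop (𝓝 F)) {z : ℂ} (hz : z.im ≠ 0) :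
    Tendsto (fun n => stieltjes (m n : Measure ℝ) z) atTop (𝓝 (stieltjes (F : Measure ℝ) z)) := by
  have sub_ne_zero (x : ℝ) : (x : ℂ) - z ≠ 0 :=
    norm_pos_iff.1 ((abs_pos.2 hz).trans_le (abs_im_le_norm_ofReal_sub z x))
  exact (ProbabilityMeasure.tendsto_iff_forall_integral_rclike_tendsto ℂ).1 hm <|
    .ofNormedAddCommGroup (fun x : ℝ => 1 / ((x : ℂ) - z))
      (continuous_const.div (by fun_prop) sub_ne_zero) (1 / |z.im|) (norm_one_div_ofReal_sub_le hz)

/-! ### The limit of the Gauss quadratures -/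

namespace IsPosDef

lemma exists_tendsto_gaussMeasure (h : IsPosDef s) :
    ∃ (m : ℕ → ProbabilityMeasure ℝ) (F : ProbabilityMeasure ℝ) (φ : ℕ → ℕ),
      Tendsto m atTop (𝓝 F) ∧ Tendsto φ atTop atTop ∧
      ∀ n, (m n : Measure ℝ) = gaussMeasure s (φ n) := by
  let m (n : ℕ) : ProbabilityMeasure ℝ :=
    ⟨gaussMeasure s (n + 2), (h.isExactBelow_gaussMeasure _).isProbabilityMeasure h (by omega)⟩
  have integral_abs_le (n : ℕ) :
      ∫ x, ‖x‖ ∂(m n : Measure ℝ) ≤ momentFunctional s (X ^ 2 + 1) := by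
    have degree_lt : (X ^ 2 + 1 : ℝ[X]).degree < (2 * (n + 2) : ℕ) := by
      refine (show (X ^ 2 + 1 : ℝ[X]).degree ≤ 2 by compute_degree).trans_lt ?_
      exact_mod_cast (by omega)
    rw [← (h.isExactBelow_gaussMeasure (n + 2)).integral_eval _ degree_lt]
    refine integral_mono (integrable_gaussMeasure s _ _) (integrable_gaussMeasure s _ _)
      fun x => ?_
    simp only [Real.norm_eq_abs, eval_add, eval_pow, eval_X, eval_one]
    nlinarith [sq_abs x, sq_nonneg (|x| - 1)]
  obtain ⟨F, φ, hφ, hF⟩ := exists_subseq_tendsto_of_integral_norm_le m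
    (fun n => integrable_gaussMeasure s _ _) integral_abs_le
  exact ⟨m ∘ φ, F, fun n => φ n + 2, hF, (tendsto_add_atTop_nat 2).comp hφ.tendsto_atTop,
    fun n => rfl⟩

lemma nevA₂_mul_nevD₂_sub_nevB₂_mul_nevC₂ (h : IsPosDef s) (hL : IsLimitCircle ℂ s) (u v : ℂ) :
    nevA₂ s u v * nevD₂ s u v - nevB₂ s u v * nevC₂ s u v = 1 :=
  tendsto_nhds_unique
    (((hL.tendsto_truncA u v).mul (hL.tendsto_truncD u v)).sub
      ((hL.tendsto_truncB u v).mul (hL.tendsto_truncC u v)))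
    (tendsto_const_nhds.congr fun n => (h.truncA_mul_truncD_sub_truncB_mul_truncC n u v).symm)

variable {z v t : ℂ}

lemma evalQ_add_stieltjes_gaussMeasure_mul_evalP (h : IsPosDef s) (n : ℕ) (hz : z.im ≠ 0) :
    evalQ s z n + stieltjes (gaussMeasure s n) z * evalP s z n = 0 := by
  rw [← ((h.isExactBelow_gaussMeasure n).mono (by omega)).integral_evalP_mul_one_div_sub h
    (.of_forall fun x hx => hz ?_) (integrable_gaussMeasure s n _)]
  · refine integral_eq_zero_of_ae ((ae_mem_nodes_gaussMeasure s n).mono fun x hx => ?_)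
    simp only [evalP_ofReal, h.mem_nodes.1 hx, RCLike.ofReal_zero, zero_mul, Pi.zero_apply]
  · rw [← hx]
    exact Complex.ofReal_im x

lemma evalP_ne_zero_of_im_ne_zero (h : IsPosDef s) (n : ℕ) (hz : z.im ≠ 0) : evalP s z n ≠ 0 := by
  intro h0
  have evalQ_eq_zero := h.evalQ_add_stieltjes_gaussMeasure_mul_evalP n hz
  rw [h0, mul_zero, add_zero] at evalQ_eq_zero
  have wronskian := h.jacobiWronskian_evalQ_evalP_self n z
  simp [jacobiWronskian, h0, evalQ_eq_zero] at wronskian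

lemma nevD₂_sub_nevB₂_mul_ne_zero (h : IsPosDef s) (hL : IsLimitCircle ℂ s) (hz : z.im ≠ 0)
    (hv : ∀ᶠ n in atTop, evalQ s v n ≠ 0)
    (ht : Tendsto (fun n => evalP s v n / evalQ s v n) atTop (𝓝 t)) :
    nevD₂ s z v - nevB₂ s z v * t ≠ 0 := by
  intro hD
  have tendsto_P := h.tendsto_evalP_div_evalQ (hL.tendsto_truncB z v) (hL.tendsto_truncD z v) hv ht
  have tendsto_Q := h.tendsto_evalQ_div_evalQ (hL.tendsto_truncA z v) (hL.tendsto_truncC z v) hv ht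
  have norm_le : ‖nevC₂ s z v - nevA₂ s z v * t‖ ≤
      1 / |z.im| * ‖nevD₂ s z v - nevB₂ s z v * t‖ := by
    refine le_of_tendsto_of_tendsto tendsto_Q.norm (tendsto_P.norm.const_mul (1 / |z.im|)) ?_
    filter_upwards [eventually_ne_atTop 0] with n hn
    have := (h.isExactBelow_gaussMeasure n).isProbabilityMeasure h (by omega)
    rw [norm_div, norm_div, ← mul_div_assoc,
      eq_neg_of_add_eq_zero_left (h.evalQ_add_stieltjes_gaussMeasure_mul_evalP n hz), norm_neg,
      norm_mul]
    gcongr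
    exact norm_stieltjes_le _ hz
  rw [hD, norm_zero, mul_zero, norm_le_zero_iff] at norm_le
  refine one_ne_zero (α := ℂ) ?_
  rw [← h.nevA₂_mul_nevD₂_sub_nevB₂_mul_nevC₂ hL z v]
  linear_combination nevA₂ s z v * hD - nevB₂ s z v * norm_le

lemma tendsto_stieltjes_gaussMeasure (h : IsPosDef s) (hL : IsLimitCircle ℂ s) (hz : z.im ≠ 0)
    (hv : ∀ᶠ n in atTop, evalQ s v n ≠ 0)
    (ht : Tendsto (fun n => evalP s v n / evalQ s v n) atTop (𝓝 t)) :
    Tendsto (fun n => stieltjes (gaussMeasure s n) z) atTop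
      (𝓝 (-((nevA₂ s z v * t - nevC₂ s z v) / (nevB₂ s z v * t - nevD₂ s z v)))) := by
  have tendsto_P := h.tendsto_evalP_div_evalQ (hL.tendsto_truncB z v) (hL.tendsto_truncD z v) hv ht
  have tendsto_Q := h.tendsto_evalQ_div_evalQ (hL.tendsto_truncA z v) (hL.tendsto_truncC z v) hv ht
  rw [← neg_sub, ← neg_sub (nevD₂ s z v), neg_div_neg_eq]
  refine (tendsto_Q.div tendsto_P (h.nevD₂_sub_nevB₂_mul_ne_zero hL hz hv ht)).neg.congr'
    (hv.mono fun n hn => ?_)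
  rw [Pi.div_apply, div_div_div_cancel_right₀ hn, ← neg_div,
    div_eq_iff (h.evalP_ne_zero_of_im_ne_zero n hz)]
  linear_combination -h.evalQ_add_stieltjes_gaussMeasure_mul_evalP n hz

lemma exists_isNExtremal (h : IsPosDef s) (hL : IsLimitCircle ℂ s) {α ξ : ℝ}
    (hQ : ∀ᶠ n in atTop, evalQ s (0 : ℝ) n ≠ 0)
    (hα : Tendsto (fun n => evalP s (0 : ℝ) n / evalQ s (0 : ℝ) n) atTop (𝓝 α))
    (hξ : ∀ n, ∀ r ∈ nodes s n, ξ < r) :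
    ∃ F : Measure ℝ, IsNExtremal s α F ∧ ∀ᵐ x ∂F, ξ ≤ x := by
  have aeval_zero (q : ℝ[X]) : aeval (0 : ℂ) q = (aeval (0 : ℝ) q : ℝ) := by
    simpa using aeval_ofReal (K := ℂ) q 0
  obtain ⟨m, F, φ, hm, hφ, m_eq⟩ := h.exists_tendsto_gaussMeasure
  refine ⟨F, ⟨isHamburgerSolution_of_tendsto hm fun N => ?_, fun z hz => ?_⟩, ?_⟩
  · filter_upwards [hφ.eventually_ge_atTop N] with n hn
    rw [m_eq]
    exact (h.isExactBelow_gaussMeasure _).mono (by omega)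
  · refine tendsto_nhds_unique (tendsto_stieltjes_of_tendsto hm hz) ?_
    simp only [m_eq]
    refine (h.tendsto_stieltjes_gaussMeasure hL hz ?_ ?_).comp hφ
    · simpa only [evalQ, aeval_zero, ne_eq, Complex.ofReal_eq_zero] using hQ
    · simpa only [evalP, evalQ, aeval_zero, ← Complex.ofReal_div] using hα.ofReal
  · refine ae_mem_of_tendsto hm isClosed_Ici fun n => ?_
    rw [m_eq]
    exact (ae_mem_nodes_gaussMeasure s _).mono fun x hx => (hξ _ x hx).le

end IsPosDef

section Friedrichs

variable {μ : Measure ℝ} {ξ : ℝ}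

lemma IsHamburgerSolution.infSupport_eq (hμ : IsHamburgerSolution s μ) (h : IsPosDef s)
    (hξ : Tendsto (smallestZero s) atTop (𝓝 ξ)) (hμξ : ∀ᵐ x ∂μ, ξ ≤ x) :
    infSupport μ = (ξ : EReal) := by
  refine le_antisymm ?_ (coe_le_infSupport_iff.2 hμξ)
  by_contra! lt_infSupport
  obtain ⟨c, hξc, hc⟩ := EReal.lt_iff_exists_real_btwn.1 lt_infSupport
  have lt_nodes := hμ.lt_of_mem_nodes h (coe_le_infSupport_iff.1 hc.le)
  have c_le : c ≤ ξ := ge_of_tendsto hξ <| (eventually_ne_atTop 0).mono fun n hn =>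
    (lt_nodes n _ (h.smallestZero_mem_nodes hn)).le
  exact (EReal.coe_lt_coe_iff.1 hξc).not_ge c_le

lemma IsPosDef.infSupport_lt_of_ne (h : IsPosDef s) (hL : IsLimitCircle ℝ s)
    (hξ : Tendsto (smallestZero s) atTop (𝓝 ξ)) (hμ : IsHamburgerSolution s μ)
    (hμξ : ∀ᵐ x ∂μ, ξ ≤ x) {ν : Measure ℝ} (hν : IsHamburgerSolution s ν) (hne : ν ≠ μ) :
    infSupport ν < ξ := by
  contrapose! hne
  exact h.eq_of_tendsto_neg_evalQ_div_evalP_atTop hL hν hμ (coe_le_infSupport_iff.1 hne) hμξ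
    (h.tendsto_neg_evalQ_div_evalP_atTop hL hξ (hμ.lt_of_mem_nodes h hμξ))

lemma IsNExtremal.eq {ν : Measure ℝ} {t : ℝ} (hμ : IsNExtremal s t μ)
    (hν : IsNExtremal s t ν) : μ = ν := by
  have := hμ.1.isProbabilityMeasure
  have := hν.1.isProbabilityMeasure
  exact ext_of_stieltjes_eq fun z hz => (hμ.2 z hz).trans (hν.2 z hz).symm

end Friedrichs

end MomentProblem

end

theorem mainTheorem1 (s : ℕ → ℝ) (hs : IsIndetStieltjes s) :
    ∃ (α ξ₁ : ℝ) (F : Measure ℝ),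
      -- `α = α(s)` exists and is negative, `ξ₁` exists, and `F` is the unique Friedrichs solution
      IsAlpha s α ∧ α < 0 ∧ IsXiOne s ξ₁ ∧
      IsNExtremal s α F ∧ (∀ F' : Measure ℝ, IsNExtremal s α F' → F' = F) ∧
      infSupport F = (ξ₁ : EReal) ∧
      ∀ ν : Measure ℝ, IsHamburgerSolution s ν → ν ≠ F → infSupport ν < infSupport F := by
  obtain ⟨μ₁, μ₂, ⟨hμ₁, support_μ₁⟩, ⟨hμ₂, support_μ₂⟩, hne⟩ := hs
  rw [← ae_le_iff_support_subset] at support_μ₁ support_μ₂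
  have h := hμ₁.isPosDef_of_ne hμ₂ hne
  have hL := h.isLimitCircle_of_ne hμ₁ hμ₂ hne
  have nodes_pos := hμ₁.lt_of_mem_nodes h support_μ₁
  obtain ⟨α, α_neg, hα⟩ :=
    h.exists_tendsto_evalP_div_evalQ hL.real hμ₁ hμ₂ support_μ₁ support_μ₂ hne
  obtain ⟨ξ, hξ, nodes_gt⟩ := h.exists_tendsto_smallestZero nodes_pos
  obtain ⟨F, hF, hFξ⟩ := h.exists_isNExtremal hL (h.eventually_evalQ_ne_zero nodes_pos) hα nodes_gt
  have infSupport_F := hF.1.infSupport_eq h hξ hFξ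
  refine ⟨α, ξ, F, ?_, α_neg, hξ, hF, fun F' hF' => hF'.eq hF, infSupport_F, fun ν hν hνF => ?_⟩
  · simpa only [IsAlpha, evalP, evalQ, coe_aeval_eq_eval] using hα
  · exact infSupport_F ▸ h.infSupport_lt_of_ne hL.real hξ hF.1 hFξ hν hνF
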